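/- Let $d_0(x,y)=\frac{1+2x}{1+x}+\frac{xy}{1+y+xy}$, $d_2(x,y)=\frac{xy^2}{1+y+xy}\,\frac{1+x}{1+y}$ and $d_1(x,y)=-\frac{x}{1+x}-\frac{xy}{1+y+xy}-d_2(x,y)$, and let $R_e\approx 1.4877$ be the unique positive root of $d_1(R,0)+\frac{7}{10}\sqrt{R}\,d_2(R,R)=0$. For step ratios $r=(r_k)_{k\ge2}$ put $d^{(n)}_j=d_j(r_n,r_{n-1})$ for $j=0,1,2$ and $d^{(n)}_j=0$ for $j\ge3$, and define the discrete orthogonal convolution kernels by $\vartheta^{(n)}_0=1/d^{(n)}_0$ and $\vartheta^{(n)}_{n-j}=-\frac{1}{d^{(j)}_0}\sum_{i=j+1}^{n}\vartheta^{(n)}_{n-i}d^{(i)}_{i-j}$ for $3\le j\le n-1$. Then there is a constant $K_3>0$ with $$\sum_{j=3}^{n}|\vartheta^{(n)}_{n-j}|\le K_3\quad (n\ge3)\qquad\text{and}\qquad \sum_{j=i}^{n}|\vartheta^{(j)}_{j-i}|\le K_3\quad (3\le i\le n)$$ for all step ratios in $(0,R_e]$. For every such $K_3$ the following holds. Let $\Omega\subset\mathbb{R}^d$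 be open (for example a bounded convex domain with smooth boundary), let $\varepsilon>0$ and $\kappa^*>0$, and let $\kappa$ be measurable on $\Omega$ with $|\kappa|\le\kappa^*$. Let $0=t_0<t_1<\dots<t_N$ be a time mesh with steps $\tau_k=t_k-t_{k-1}$, maximum step $\tau=\max_{1\le k\le N}\tau_k$ and ratios $r_k=\tau_k/\tau_{k-1}$ $(2\le k\le N)$. Write $\partial_\tau v^n=(v^n-v^{n-1})/\tau_n$ and $$D_3v^n=d_0(r_n,r_{n-1})\,\partial_\tau v^n+d_1(r_n,r_{n-1})\,\partial_\tau v^{n-1}+d_2(r_n,r_{n-1})\,\partial_\tau v^{n-2}.$$ Let $u^0,u^1,u^2\in L^2(\Omega)$ and $f^k\in L^2(\Omega)$, and for $3\le k\le N$ let $u^k\in H^1_0(\Omega)$ be a weak solution of $$D_3u^k=\varepsilon\Delta u^k+\kappa u^k+f^k\quad\text{in }\Omega .$$ If $0<r_k<R_e$ for $2\le k\le N$ and $\tau\le 1/(4K_3\kappa^*)$, then, with $\|\cdot\|$ the norm of $L^2(\Omega)$, $$\|u^n\|\le 2\exp\bigl(4K_3\kappa^*t_{n-1}\bigr)\Bigl(\|u^2\|+K_3\tau\|\partial_\tau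 u^1\|+4K_3\tau\|\partial_\tau u^2\|+2K_3t_n\max_{3\le k\le n}\|f^k\|\Bigr)\quad\text{for }3\le n\le N .$$ -/

import Mathlib

open MeasureTheory
open scoped ContDiff

noncomputable section

namespace BDF3

/-! ### The variable-step BDF3 formula -/

/-- The coefficient function `d₀(x, y)` of the BDF3 formula. -/
def d0 (x y : ℝ) : ℝ :=
  (1 + 2 * x) / (1 + x) + x * y / (1 + y + x * y)

/-- The coefficient function `d₁(x, y)` of the BDF3 formula. -/
def d1 (x y : ℝ) : ℝ :=
  -(x / (1 + x)) - x * y / (1 + y + x * y)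
    - x * y ^ 2 / (1 + y + x * y) * ((1 + x) / (1 + y))

/-- The coefficient function `d₂(x, y)` of the BDF3 formula. -/
def d2 (x y : ℝ) : ℝ :=
  x * y ^ 2 / (1 + y + x * y) * ((1 + x) / (1 + y))

/-- `0 = t₀ < t₁ < ⋯ < t_N`; only the values `t k` with `k ≤ N` matter. -/
structure IsTimeMesh (t : ℕ → ℝ) (N : ℕ) : Prop where
  zero : t 0 = 0
  lt_succ : ∀ k, k < N → t k < t (k + 1)

/-- The step size `τ_k = t_k - t_{k-1}`, meant for `k ≥ 1`. -/
def stepSize (t : ℕ → ℝ) (k : ℕ) : ℝ := t k - t (k - 1)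

/-- The step ratio `r_k = τ_k / τ_{k-1}`, meant for `k ≥ 2`. -/
def stepRatio (t : ℕ → ℝ) (k : ℕ) : ℝ := stepSize t k / stepSize t (k - 1)

/-- The maximum step size `τ = max_{1 ≤ k ≤ N} τ_k`. -/
def maxStep (t : ℕ → ℝ) (N : ℕ) (hN : 1 ≤ N) : ℝ :=
  (Finset.Icc 1 N).sup' (Finset.nonempty_Icc.2 hN) (stepSize t)

/-- The difference quotient `∂_τ v^n = (v^n - v^{n-1}) / τ_n`, meant for `n ≥ 1`. -/
def diffQuot {V : Type*} [AddCommGroup V] [Module ℝ V] (t : ℕ → ℝ) (v : ℕ → V) (n : ℕ) : V :=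
  (stepSize t n)⁻¹ • (v n - v (n - 1))

/-- The variable-step BDF3 formula `D₃ v^n`, meant for `n ≥ 3`. -/
def D3 {V : Type*} [AddCommGroup V] [Module ℝ V] (t : ℕ → ℝ) (v : ℕ → V) (n : ℕ) : V :=
  d0 (stepRatio t n) (stepRatio t (n - 1)) • diffQuot t v n
    + d1 (stepRatio t n) (stepRatio t (n - 1)) • diffQuot t v (n - 1)
    + d2 (stepRatio t n) (stepRatio t (n - 1)) • diffQuot t v (n - 2)

/-! ### The step-ratio limit -/

/-- The equation for the step-ratio limit has exactly one positive root. -/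
theorem existsUnique_stepRatioLimit :
    ∃! R : ℝ, 0 < R ∧ d1 R 0 + 7 / 10 * √R * d2 R R = 0 := by
  have key : ∀ s : ℝ, 0 < s → (d1 (s ^ 2) 0 + 7 / 10 * √(s ^ 2) * d2 (s ^ 2) (s ^ 2) = 0 ↔
      10 * (1 + s ^ 2 + s ^ 4) = 7 * s ^ 5 * (1 + s ^ 2)) := by
    intro s hs
    have h1 : (1 + s ^ 2 : ℝ) ≠ 0 := by positivity
    have h2 : (1 + s ^ 2 + s ^ 2 * s ^ 2 : ℝ) ≠ 0 := by positivity
    have e : d1 (s ^ 2) 0 + 7 / 10 * √(s ^ 2) * d2 (s ^ 2) (s ^ 2)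
        = s ^ 2 * (7 * s ^ 5 * (1 + s ^ 2) - 10 * (1 + s ^ 2 + s ^ 4))
          / (10 * (1 + s ^ 2) * (1 + s ^ 2 + s ^ 2 * s ^ 2)) := by
      rw [Real.sqrt_sq hs.le]
      unfold d1 d2
      field_simp
      ring
    rw [e, div_eq_zero_iff]
    have h3 : (10 * (1 + s ^ 2) * (1 + s ^ 2 + s ^ 2 * s ^ 2) : ℝ) ≠ 0 := by positivity
    have h4 : (s ^ 2 : ℝ) ≠ 0 := by positivity
    simp only [h3, or_false, mul_eq_zero, h4, false_or]
    constructor <;> intro h <;> linarith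
  have uniq : ∀ s t : ℝ, 0 < s → s < t →
      10 * (1 + s ^ 2 + s ^ 4) = 7 * s ^ 5 * (1 + s ^ 2) →
      10 * (1 + t ^ 2 + t ^ 4) = 7 * t ^ 5 * (1 + t ^ 2) → False := by
    intro s t hs hst h1 h2
    have ht : 0 < t := hs.trans hst
    have p1 : s ^ 5 < t ^ 5 := pow_lt_pow_left₀ hst hs.le (by norm_num)
    have p3 : s ^ 3 < t ^ 3 := pow_lt_pow_left₀ hst hs.le (by norm_num)
    have p2 : s ^ 2 < t ^ 2 := pow_lt_pow_left₀ hst hs.le (by norm_num)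
    have a1 : 10 * (1 + t ^ 2 + t ^ 4) * s ^ 5 < 10 * (1 + s ^ 2 + s ^ 4) * t ^ 5 := by
      have b1 : s ^ 2 * t ^ 2 * s ^ 3 < s ^ 2 * t ^ 2 * t ^ 3 := by gcongr
      have b2 : s ^ 4 * t ^ 4 * s < s ^ 4 * t ^ 4 * t := by gcongr
      nlinarith
    have a2 : 7 * s ^ 5 * (1 + s ^ 2) * t ^ 5 < 7 * t ^ 5 * (1 + t ^ 2) * s ^ 5 := by
      have : s ^ 5 * t ^ 5 * s ^ 2 < s ^ 5 * t ^ 5 * t ^ 2 := by gcongr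
      nlinarith
    rw [h1, h2] at a1
    linarith
  obtain ⟨s, hs, hs0⟩ : ∃ s ∈ Set.Icc (1 : ℝ) 2,
      10 * (1 + s ^ 2 + s ^ 4) - 7 * s ^ 5 * (1 + s ^ 2) = 0 := by
    have hc : ContinuousOn
        (fun s : ℝ => 10 * (1 + s ^ 2 + s ^ 4) - 7 * s ^ 5 * (1 + s ^ 2)) (Set.Icc 1 2) := by
      fun_prop
    exact intermediate_value_Icc' (by norm_num) hc ⟨by norm_num, by norm_num⟩
  have hs1 : 0 < s := by linarith [hs.1]
  refine ⟨s ^ 2, ⟨by positivity, (key s hs1).2 (by linarith)⟩, ?_⟩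
  rintro R ⟨hR, hR0⟩
  have hq : 0 < √R := Real.sqrt_pos.2 hR
  have hR2 : √R ^ 2 = R := Real.sq_sqrt hR.le
  rw [← hR2] at hR0 ⊢
  have hk := (key _ hq).1 hR0
  rcases lt_trichotomy (√R) s with h | h | h
  · exact (uniq _ _ hq h hk (by linarith)).elim
  · rw [h]
  · exact (uniq _ _ hs1 h (by linarith) hk).elim

/-- The step-ratio limit `R_e ≈ 1.4877`, the unique positive root of
`d₁(R, 0) + (7/10) √R d₂(R, R) = 0`. -/
def stepRatioLimit : ℝ := existsUnique_stepRatioLimit.choose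

/-! ### Discrete orthogonal convolution kernels -/

/-- The discrete BDF3 kernel `d^{(n)}_j` attached to the step ratios `r`. -/
def kernel (r : ℕ → ℝ) (n : ℕ) : ℕ → ℝ
  | 0 => d0 (r n) (r (n - 1))
  | 1 => d1 (r n) (r (n - 1))
  | 2 => d2 (r n) (r (n - 1))
  | _ => 0

/-- The discrete orthogonal convolution kernel `ϑ^{(n)}_m`, meant for `n ≥ 3` and `m ≤ n - 3`:
`ϑ^{(n)}_0 = 1 / d^{(n)}_0`, and for `m = n - j ≥ 1`
`ϑ^{(n)}_{n-j} = -(1 / d^{(j)}_0) ∑_{i=j+1}^{n} ϑ^{(n)}_{n-i} d^{(i)}_{i-j}`.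
The summation variable is `l = n - i`. -/
def docKernel (r : ℕ → ℝ) (n : ℕ) : ℕ → ℝ
  | 0 => 1 / kernel r n 0
  | m + 1 => -(1 / kernel r (n - (m + 1)) 0) *
      ∑ l : Fin (m + 1), docKernel r n l * kernel r (n - l) (m + 1 - l)
  termination_by m => m
  decreasing_by exact l.2

/-- `K` bounds the absolute row sums and column sums of the discrete orthogonal convolution kernels,
uniformly over all step ratios in `(0, R_e]` and all time levels. -/
structure IsDOCBound (K : ℝ) : Prop where
  pos : 0 < K
  row : ∀ (r : ℕ → ℝ) (n : ℕ), 3 ≤ n →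
    (∀ k, 2 ≤ k → k ≤ n → 0 < r k ∧ r k ≤ stepRatioLimit) →
    ∑ j ∈ Finset.Icc 3 n, |docKernel r n (n - j)| ≤ K
  col : ∀ (r : ℕ → ℝ) (i n : ℕ), 3 ≤ i → i ≤ n →
    (∀ k, 2 ≤ k → k ≤ n → 0 < r k ∧ r k ≤ stepRatioLimit) →
    ∑ j ∈ Finset.Icc i n, |docKernel r j (j - i)| ≤ K

/-! ### The time-discrete reaction-diffusion problem -/

/-- The Hilbert space `L²(Ω)`. -/
abbrev L2 {d : ℕ} (Ω : Set (EuclideanSpace ℝ (Fin d))) : Type :=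
  Lp ℝ 2 (volume.restrict Ω)

/-- The Hilbert space `L²(Ω; ℝ^d)`. -/
abbrev L2Vec {d : ℕ} (Ω : Set (EuclideanSpace ℝ (Fin d))) : Type :=
  Lp (EuclideanSpace ℝ (Fin d)) 2 (volume.restrict Ω)

/-- Test functions `φ ∈ C_c^∞(Ω)`. -/
structure IsTestFunction {d : ℕ} (Ω : Set (EuclideanSpace ℝ (Fin d)))
    (φ : EuclideanSpace ℝ (Fin d) → ℝ) : Prop where
  smooth : ContDiff ℝ ∞ φ
  compact : HasCompactSupport φ
  support : tsupport φ ⊆ Ω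

/-- `g ∈ L²(Ω; ℝ^d)` is the weak gradient of `u ∈ L²(Ω)`. -/
def HasWeakGradient {d : ℕ} {Ω : Set (EuclideanSpace ℝ (Fin d))} (u : L2 Ω) (g : L2Vec Ω) : Prop :=
  ∀ φ, IsTestFunction Ω φ → ∀ i : Fin d,
    ∫ x in Ω, u x * gradient φ x i = -∫ x in Ω, g x i * φ x

/-- The pairs `(φ, ∇φ)` with `φ ∈ C_c^∞(Ω)`, as elements of `L²(Ω) × L²(Ω; ℝ^d)`. -/
def testGraph {d : ℕ} (Ω : Set (EuclideanSpace ℝ (Fin d))) : Set (L2 Ω × L2Vec Ω) :=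
  {p | ∃ φ, IsTestFunction Ω φ ∧
    (p.1 =ᵐ[volume.restrict Ω] φ) ∧ (p.2 =ᵐ[volume.restrict Ω] gradient φ)}

/-- `u ∈ H¹₀(Ω)` with weak gradient `g`: `u` is the limit of functions in `C_c^∞(Ω)` with respect to
the norm of `H¹(Ω)`. -/
structure MemH10 {d : ℕ} {Ω : Set (EuclideanSpace ℝ (Fin d))} (u : L2 Ω) (g : L2Vec Ω) : Prop where
  weakGradient : HasWeakGradient u g
  mem_closure : (u, g) ∈ closure (testGraph Ω)

/-- `u` solves `D₃ u^k = ε Δ u^k + κ u^k + f^k` in `Ω`, `u^k = 0` on `∂Ω`, for `3 ≤ k ≤ N`, in the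
weak sense. The starting values `u^0, u^1, u^2` are arbitrary elements of `L²(Ω)`. -/
def IsBDF3Solution {d : ℕ} (Ω : Set (EuclideanSpace ℝ (Fin d))) (ε : ℝ)
    (κ : EuclideanSpace ℝ (Fin d) → ℝ) (t : ℕ → ℝ) (N : ℕ) (f u : ℕ → L2 Ω) : Prop :=
  ∀ k, 3 ≤ k → k ≤ N → ∃ g : L2Vec Ω, MemH10 (u k) g ∧
    ∀ φ, IsTestFunction Ω φ →
      ∫ x in Ω, D3 t u k x * φ x =
        -ε * (∫ x in Ω, inner ℝ (g x) (gradient φ x))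
          + ∫ x in Ω, (κ x * u k x + f k x) * φ x

end BDF3

end

open BDF3

namespace BDF3

/-! ### Bounds for the coefficient functions -/

/-! The numerical work uses only `R_e < 3/2`, so every ratio lies in `[0, 3/2]`. Three facts carry
the theorem.

Decay. The orthogonal kernels invert the BDF3 convolution (`sum_docKernel_bdfConv`), so for fixed
`i` the sequence `n ↦ ϑ^{(n)}_{n-i}` is the response of the BDF3 recursion to a unit impulse at `i`.
The recursion contracts by `9/10` per step (`contraction_bound`), so row and column sums are
dominated by a geometric series (`exists_isDOCBound`).

Positivity. A quadratic energy in two consecutive values makes the BDF3 form, weighted by the steps,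
nonnegative for sequences with zero starting values (`bdfEnergy_step`). By inversion the form of the
orthogonal kernels is nonnegative too (`sum_docKernel_inner_nonneg`).

Stability. Convolving the scheme with `ϑ` turns `D₃ u` into `∂_τ u` plus a starting term. Testing
with `2 τ_k u^k` and summing, the diffusion part has a sign and drops out (`energy_inequality`). Row
sums control `κ u + f`, column sums control the starting terms, and an implicit Grönwall argument
gives a product of `(1 - 2Kκ*τ_k)⁻¹` (`norm_le_prod`). The stated constants, with `t_{n-1}` in the
exponent, need a careful comparison of this product with the exponential (`prod_one_sub_inv_le`). -/

theorem stepRatioLimit_lt : stepRatioLimit < 3 / 2 := by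
  obtain ⟨hR, h⟩ := existsUnique_stepRatioLimit.choose_spec.1
  change 0 < stepRatioLimit at hR
  change d1 stepRatioLimit 0 + 7 / 10 * √stepRatioLimit * d2 stepRatioLimit stepRatioLimit = 0 at h
  generalize stepRatioLimit = R at hR h
  by_contra! hc
  -- `1.22² = 1.4884 < 3/2`; this already makes the left side of the defining equation positive for
  -- all `R ≥ 3/2`.
  have hs : (1.22 : ℝ) ≤ √R := Real.le_sqrt_of_sq_le (by norm_num; linarith)
  have e : d1 R 0 + 7 / 10 * √R * d2 R R =
      R * (7 / 10 * √R * R ^ 2 * (1 + R) - (1 + R + R ^ 2)) / ((1 + R) * (1 + R + R * R)) := by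
    unfold d1 d2
    field_simp
    ring
  have h1 : 0 < 7 / 10 * √R * R ^ 2 * (1 + R) - (1 + R + R ^ 2) := by
    have h2 : 7 / 10 * 1.22 * (R ^ 2 * (1 + R)) ≤ 7 / 10 * √R * (R ^ 2 * (1 + R)) := by gcongr
    nlinarith [mul_nonneg (sub_nonneg.2 hc) (sub_nonneg.2 hc), mul_nonneg hR.le (sq_nonneg (R - 3 / 2))]
  have h3 : 0 < d1 R 0 + 7 / 10 * √R * d2 R R := by
    rw [e]
    positivity
  exact h3.ne' h

/-- The auxiliary quantity `xy / (1 + y + xy)` occurring in the coefficient functions. -/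
noncomputable def ePart (x y : ℝ) : ℝ := x * y / (1 + y + x * y)

/-- With `p = x/(1+x)`, `e = ePart x y` and `q = d2 x y`, the coefficients are `1 + p + e`, `-p - e
- q` and `q`. The later estimates are linear or quadratic in `p`, `e`, `q`. -/
theorem d0_eq {x : ℝ} (y : ℝ) (hx : 0 ≤ x) : d0 x y = 1 + x / (1 + x) + ePart x y := by
  have : 1 + x ≠ 0 := by positivity
  unfold d0 ePart
  field_simp
  ring

theorem d2_eq (x y : ℝ) : d2 x y = ePart x y * (y * (1 + x) / (1 + y)) := by
  unfold d2 ePart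
  ring

theorem d1_eq (x y : ℝ) : d1 x y = -(x / (1 + x)) - ePart x y - d2 x y := rfl

section
variable {x y : ℝ} (hx : 0 ≤ x) (hy : 0 ≤ y) (hx' : x ≤ 3 / 2) (hy' : y ≤ 3 / 2)
include hx hy

theorem ePart_nonneg : 0 ≤ ePart x y := by
  unfold ePart; positivity

theorem d2_nonneg : 0 ≤ d2 x y := by
  unfold d2; positivity

theorem d0_ge_one : 1 ≤ d0 x y := by
  have := ePart_nonneg hx hy
  have : 0 ≤ x / (1 + x) := by positivity
  rw [d0_eq y hx]
  linarith

include hx' hy'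

theorem le_ePart : 4 / 19 * (x * y) ≤ ePart x y := by
  unfold ePart
  rw [le_div_iff₀ (by positivity)]
  have : 1 + y + x * y ≤ 19 / 4 := by nlinarith
  nlinarith [mul_nonneg hx hy]

theorem ePart_le : ePart x y ≤ 9 / 19 := by
  unfold ePart
  rw [div_le_div_iff₀ (by positivity) (by norm_num)]
  nlinarith

theorem d2_le_ePart : d2 x y ≤ 3 / 2 * ePart x y := by
  rw [d2_eq, mul_comm]
  refine mul_le_mul_of_nonneg_right ?_ (ePart_nonneg hx hy)
  rw [div_le_iff₀ (by positivity)]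
  nlinarith

theorem d2_le_mul : d2 x y ≤ 9 / 19 * x := by
  have h : d2 x y = x * (y ^ 2 * (1 + x) / ((1 + y + x * y) * (1 + y))) := by
    unfold d2
    field_simp
  rw [h, mul_comm]
  refine mul_le_mul_of_nonneg_right ?_ hx
  rw [div_le_div_iff₀ (by positivity) (by norm_num)]
  obtain ⟨u, rfl⟩ : ∃ u, x = 3 / 2 - u := ⟨3 / 2 - x, by ring⟩
  obtain ⟨v, rfl⟩ : ∃ v, y = 3 / 2 - v := ⟨3 / 2 - y, by ring⟩
  have hu : 0 ≤ u := by linarith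
  have hv : 0 ≤ v := by linarith
  nlinarith [mul_nonneg hx hy, mul_nonneg hx hv, mul_nonneg hy hv, mul_nonneg hu hy, mul_nonneg hu hv,
    mul_nonneg (mul_nonneg hx hy) hv, mul_nonneg (mul_nonneg hu hy) hv,
    mul_nonneg (mul_nonneg hu hy) hy, mul_nonneg (mul_nonneg hx hy) hy]

theorem d2_le : d2 x y ≤ 27 / 38 := by
  linarith [d2_le_mul hx hy hx' hy']

omit hy hy' in
theorem x_div_le : x / (1 + x) ≤ 3 / 5 := by
  rw [div_le_iff₀ (by positivity)]
  linarith

theorem abs_d1_le : |d1 x y| ≤ 9 / 5 := by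
  have h1 := d2_le hx hy hx' hy'
  have h2 := d2_nonneg hx hy
  have h3 := ePart_le hx hy hx' hy'
  have h4 := ePart_nonneg hx hy
  have h5 := x_div_le hx hx'
  have h6 : 0 ≤ x / (1 + x) := by positivity
  rw [d1_eq, abs_le]
  constructor <;> linarith

/-- The two-step recursion contracts in the norm `max (|w|, 2 |z|)`, `z = w⁺ - (2/5) w`. -/
theorem contraction_bound :
    |(-d1 x y) - 2 / 5 * d0 x y| + 2 * |2 / 5 * ((-d1 x y) - 2 / 5 * d0 x y) - d2 x y|
      ≤ 9 / 10 * d0 x y := by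
  have h1 := d2_le hx hy hx' hy'
  have h2 := d2_nonneg hx hy
  have h7 := d2_le_ePart hx hy hx' hy'
  have h3 := ePart_le hx hy hx' hy'
  have h4 := ePart_nonneg hx hy
  have h5 := x_div_le hx hx'
  have h6 : 0 ≤ x / (1 + x) := by positivity
  have h8 := d2_le_mul hx hy hx' hy'
  -- `q > 11/20` forces `x > 1` by `q ≤ 9x/19`, hence `p ≥ 1/2`. This excludes large `q` with small
  -- `p`, and what remains is linear in `p`, `e`, `q`.
  have h9 : d2 x y ≤ 11 / 20 ∨ 1 / 2 ≤ x / (1 + x) := by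
    rcases le_or_gt (d2 x y) (11 / 20) with h | h
    · exact Or.inl h
    · right
      rw [le_div_iff₀ (by positivity)]
      linarith
  rw [d1_eq, d0_eq y hx]
  generalize ePart x y = e at *
  generalize d2 x y = q at *
  generalize x / (1 + x) = p at *
  rcases abs_cases (-(-p - e - q) - 2 / 5 * (1 + p + e)) with ⟨e1, _⟩ | ⟨e1, _⟩ <;>
  rcases abs_cases (2 / 5 * (-(-p - e - q) - 2 / 5 * (1 + p + e)) - q) with ⟨e2, _⟩ | ⟨e2, _⟩ <;>
  rw [e1, e2] <;> rcases h9 with h9 | h9 <;> linarith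

end

/-- The discriminant bound behind the positivity of the discrete BDF3 kernels. -/
theorem discriminant_bound {x y : ℝ} (hx : 0 ≤ x) (hy : 0 ≤ y) (hx' : x ≤ 3 / 2) (hy' : y ≤ 3 / 2) :
    x * (d1 x y + 3 / 4 + 3 / 4 * y * d2 x y) ^ 2
      ≤ d0 x y - 3 / 4 - 9 / 32 * x - x * y * d2 x y ^ 2 / 2 := by
  have h1 := d2_le hx hy hx' hy'
  have h2 := d2_nonneg hx hy
  have h7 := d2_le_ePart hx hy hx' hy'
  have h3 := le_ePart hx hy hx' hy'
  have h4 := ePart_nonneg hx hy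
  have h5 := x_div_le hx hx'
  have h8 := d2_le_mul hx hy hx' hy'
  set L := d1 x y + 3 / 4 + 3 / 4 * y * d2 x y with hL
  have hLu : L ≤ 3 / 4 - x / (1 + x) := by
    have : y * d2 x y ≤ 3 / 2 * d2 x y := by gcongr
    rw [hL, d1_eq]
    linarith
  -- `L = 3/4 - p - (e + q(1 - 3y/4))` with `p ≤ 3/5`. Since `e` increases in `x`, the bracket is
  -- estimated by its value at `x = 3/2` while `1 - 3y/4 ≥ 0`; otherwise its last term is
  -- nonpositive.
  have hLl : -(44 / 100) ≤ L := by
    have hd : d2 x y * (1 - 3 / 4 * y) + ePart x y ≤ 59 / 100 := by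
      have he : ePart x y ≤ 3 * y / (2 + 5 * y) := by
        unfold ePart
        rw [div_le_div_iff₀ (by positivity) (by positivity)]
        nlinarith [mul_nonneg hy (sub_nonneg.2 hx'),
          mul_nonneg (mul_nonneg hy hy) (sub_nonneg.2 hx')]
      rcases le_total 0 (1 - 3 / 4 * y) with hc | hc
      · have hd2 : d2 x y ≤ 3 * y / (2 + 5 * y) * (y * (5 / 2) / (1 + y)) := by
          rw [d2_eq]
          gcongr
          linarith
        calc d2 x y * (1 - 3 / 4 * y) + ePart x y
            ≤ 3 * y / (2 + 5 * y) * (y * (5 / 2) / (1 + y)) * (1 - 3 / 4 * y)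
              + 3 * y / (2 + 5 * y) := by gcongr
          _ = 3 * y * (y * (5 / 2) * (1 - 3 / 4 * y) + (1 + y)) / ((2 + 5 * y) * (1 + y)) := by
              field_simp
          _ ≤ 59 / 100 := by
              rw [div_le_div_iff₀ (by positivity) (by norm_num)]
              nlinarith [mul_nonneg hy (sq_nonneg (y - 4 / 5)), sq_nonneg (y - 4 / 5),
                mul_nonneg hy hc, mul_nonneg (mul_nonneg hy hy) (sq_nonneg (y - 4 / 5))]
      · have := ePart_le hx hy hx' hy'
        have := mul_nonpos_of_nonneg_of_nonpos h2 hc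
        linarith
    rw [hL, d1_eq]
    linarith
  have hq : x * y * d2 x y ^ 2 ≤ x * y * (9 / 19 * x) ^ 2 := by gcongr
  have hP : 1 / 4 + x / (1 + x) - 9 / 32 * x + x * y * (4 / 19 - 81 / 722 * x ^ 2) ≤
      d0 x y - 3 / 4 - 9 / 32 * x - x * y * d2 x y ^ 2 / 2 := by
    rw [d0_eq y hx]
    linarith
  -- This removes `y` from the right side. The case split then balances `L ≤ 3/4 - p`: for small `x`
  -- the factor `x` makes `|L| ≤ 3/4` enough, while for `x ≥ 1/2` one has `p ≥ 1/3` and so `|L| ≤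
  -- 0.44`.
  have hP2 : 1 / 4 + x / (1 + x) - 9 / 32 * x - x * (1 / 15) ≤
      d0 x y - 3 / 4 - 9 / 32 * x - x * y * d2 x y ^ 2 / 2 := by
    refine le_trans ?_ hP
    have : -(1 / 15) ≤ y * (4 / 19 - 81 / 722 * x ^ 2) := by
      have : -(4 / 95) ≤ 4 / 19 - 81 / 722 * x ^ 2 := by nlinarith
      nlinarith
    nlinarith
  refine le_trans ?_ hP2
  rcases le_total x (1 / 2) with hc | hc
  · have h6 : 2 / 3 * x ≤ x / (1 + x) := by
      rw [le_div_iff₀ (by positivity)]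
      nlinarith
    have : L ^ 2 ≤ (3 / 4) ^ 2 := by
      have : 0 ≤ x / (1 + x) := by positivity
      apply sq_le_sq'  <;> linarith
    nlinarith [mul_le_mul_of_nonneg_left this hx]
  · have h6 : 1 / 3 ≤ x / (1 + x) := by
      rw [le_div_iff₀ (by positivity)]
      nlinarith
    have h9 : L ^ 2 ≤ (44 / 100) ^ 2 := by
      apply sq_le_sq' <;> linarith
    have h10 := mul_le_mul_of_nonneg_left h9 hx
    have h11 : 1 / 4 + x / (1 + x) - 9 / 32 * x - x * (1 / 15) - x * (44 / 100) ^ 2 =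
      (1 / 4 * (1 + x) + x - (9 / 32 + 1 / 15 + (44 / 100) ^ 2) * (x * (1 + x))) / (1 + x) := by
      field_simp
      ring
    have : 0 ≤ 1 / 4 + x / (1 + x) - 9 / 32 * x - x * (1 / 15) - x * (44 / 100) ^ 2 := by
      rw [h11]
      apply div_nonneg _ (by positivity)
      nlinarith
    linarith

/-! ### Algebra of the discrete orthogonal convolution kernels -/

section
variable {V : Type*} [AddCommGroup V] [Module ℝ V]

/-- The discrete convolution `∑ d^{(n)}_{n-k} y_k` with the BDF3 kernels. -/
noncomputable def bdfConv (r : ℕ → ℝ) (y : ℕ → V) (n : ℕ) : V :=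
  kernel r n 0 • y n + kernel r n 1 • y (n - 1) + kernel r n 2 • y (n - 2)

/-- `ϑ^{(n)}_{m-1}`, with the value `0` for `m = 0`. -/
noncomputable def docPred (r : ℕ → ℝ) (n : ℕ) : ℕ → ℝ
  | 0 => 0
  | m + 1 => docKernel r n m

theorem docKernel_zero (r : ℕ → ℝ) (n : ℕ) : docKernel r n 0 = 1 / kernel r n 0 := by
  rw [docKernel]

theorem kernel_add_three (r : ℕ → ℝ) (n m : ℕ) : kernel r n (m + 3) = 0 := rfl

/-- Only `d_1` and `d_2` survive in the defining sum, which therefore has at most two terms. -/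
theorem docKernel_succ (r : ℕ → ℝ) {n m : ℕ} (h : m + 1 ≤ n) :
    docKernel r n (m + 1) = -(1 / kernel r (n - (m + 1)) 0) *
      (docKernel r n m * kernel r (n - m) 1 + docPred r n m * kernel r (n - m + 1) 2) := by
  rw [docKernel]
  congr 1
  rw [Fin.sum_univ_castSucc]
  rcases m with _ | m
  · simp [docPred]
  · rw [Fin.sum_univ_castSucc, Finset.sum_eq_zero]
    · simp only [Fin.val_last, Fin.val_castSucc, docPred, zero_add]
      have h1 : m + 1 + 1 - m = 2 := by omega
      have h2 : m + 1 + 1 - (m + 1) = 1 := by omega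
      rw [h1, h2, add_comm]
      congr 2
      congr 1
      omega
    · intro i _
      obtain ⟨k, hk⟩ : ∃ k, m + 1 + 1 - (i : ℕ) = k + 3 := ⟨m - 1 - i, by omega⟩
      simp only [Fin.val_castSucc]
      rw [hk, kernel_add_three, mul_zero]


/-- The recursion for `ϑ` is designed to cancel the coefficient of each `y_j` in turn from the top,
so a partial sum leaves `y_n` and two values at its lower end. -/
theorem sum_range_docKernel_bdfConv (r : ℕ → ℝ) (y : ℕ → V) {n l : ℕ} (hl : l + 3 ≤ n)
    (h0 : ∀ k, 3 ≤ k → k ≤ n → kernel r k 0 ≠ 0) :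
    ∑ i ∈ Finset.range (l + 1), docKernel r n i • bdfConv r y (n - i) =
      y n + (docKernel r n l * kernel r (n - l) 1 + docPred r n l * kernel r (n - l + 1) 2) •
          y (n - l - 1)
        + (docKernel r n l * kernel r (n - l) 2) • y (n - l - 2) := by
  induction l with
  | zero =>
    have := h0 n (by omega) le_rfl
    rw [zero_add, Finset.sum_range_one, docKernel_zero]
    simp only [bdfConv, docPred, Nat.sub_zero, smul_add, smul_smul, zero_mul, add_zero]
    rw [one_div_mul_cancel this, one_smul]
  | succ l ih =>
    have h := h0 (n - (l + 1)) (by omega) (by omega)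
    have hX : docKernel r n (l + 1) * kernel r (n - (l + 1)) 0 =
        -(docKernel r n l * kernel r (n - l) 1 + docPred r n l * kernel r (n - l + 1) 2) := by
      rw [docKernel_succ r (by omega)]
      field_simp
    have e1 : n - (l + 1) + 1 = n - l := by omega
    have e2 : n - l - 2 = n - (l + 1) - 1 := by omega
    have e3 : n - l - 1 = n - (l + 1) := by omega
    rw [Finset.sum_range_succ, ih (by omega), bdfConv, smul_add, smul_add, smul_smul, hX, e1, e2, e3]
    simp only [docPred]
    module

theorem sum_Icc_eq_sum_range {M : Type*} [AddCommMonoid M] (F : ℕ → ℕ → M) {i n : ℕ} (hn : i ≤ n) :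
    ∑ j ∈ Finset.Icc i n, F (n - j) j = ∑ l ∈ Finset.range (n - i + 1), F l (n - l) := by
  refine Finset.sum_nbij' (fun j => n - j) (fun l => n - l) ?_ ?_ ?_ ?_ ?_ <;>
    intro j hj <;> simp only [Finset.mem_Icc, Finset.mem_range] at hj ⊢
  any_goals omega
  rw [Nat.sub_sub_self hj.2]

/-- The discrete orthogonal convolution kernels invert the BDF3 convolution, up to the starting
values. -/
theorem sum_docKernel_bdfConv (r : ℕ → ℝ) (y : ℕ → V) {n : ℕ} (hn : 3 ≤ n)
    (h0 : ∀ k, 3 ≤ k → k ≤ n → kernel r k 0 ≠ 0) :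
    ∑ j ∈ Finset.Icc 3 n, docKernel r n (n - j) • bdfConv r y j =
      y n + ((docKernel r n (n - 3) * kernel r 3 1 + docPred r n (n - 3) * kernel r 4 2) • y 2
        + (docKernel r n (n - 3) * kernel r 3 2) • y 1) := by
  rw [sum_Icc_eq_sum_range (fun m j => docKernel r n m • bdfConv r y j) hn,
    sum_range_docKernel_bdfConv r y (by omega) h0]
  have e : n - (n - 3) = 3 := by omega
  rw [e]
  simp only [Nat.reduceAdd, Nat.reduceSub]
  abel

/-- The solution `y` of `∑ d^{(n)}_{n-k} y_k = g_n` for `n ≥ 3` with vanishing starting values. -/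
noncomputable def bdfSolve (r : ℕ → ℝ) (g : ℕ → V) : ℕ → V
  | 0 => 0
  | 1 => 0
  | 2 => 0
  | n + 3 => (kernel r (n + 3) 0)⁻¹ •
      (g (n + 3) - kernel r (n + 3) 1 • bdfSolve r g (n + 2) - kernel r (n + 3) 2 • bdfSolve r g (n + 1))

theorem bdfConv_bdfSolve (r : ℕ → ℝ) (g : ℕ → V) {n : ℕ} (hn : 3 ≤ n) (h0 : kernel r n 0 ≠ 0) :
    bdfConv r (bdfSolve r g) n = g n := by
  obtain ⟨n, rfl⟩ := Nat.exists_eq_add_of_le' hn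
  have e1 : n + 3 - 1 = n + 2 := rfl
  have e2 : n + 3 - 2 = n + 1 := rfl
  rw [bdfConv, e1, e2, bdfSolve, smul_inv_smul₀ h0]
  abel

theorem sum_docKernel_smul (r : ℕ → ℝ) (g : ℕ → V) {n : ℕ} (hn : 3 ≤ n)
    (h0 : ∀ k, 3 ≤ k → k ≤ n → kernel r k 0 ≠ 0) :
    ∑ j ∈ Finset.Icc 3 n, docKernel r n (n - j) • g j = bdfSolve r g n := by
  have h := sum_docKernel_bdfConv r (bdfSolve r g) hn h0
  have h1 : bdfSolve r g 1 = 0 := by rw [bdfSolve]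
  have h2 : bdfSolve r g 2 = 0 := by rw [bdfSolve]
  rw [h1, h2, smul_zero, smul_zero, add_zero, add_zero] at h
  rw [← h]
  refine Finset.sum_congr rfl fun j hj => ?_
  rw [Finset.mem_Icc] at hj
  rw [bdfConv_bdfSolve r g hj.1 (h0 j hj.1 hj.2)]

end

/-! ### Uniform bounds for the discrete orthogonal convolution kernels -/

/-- The definition of `ϑ^{(n)}` recurs downwards for fixed `n`; the impulse response recurs forwards
in `n` for fixed `i`, where the contraction applies. -/
theorem docKernel_eq_bdfSolve (r : ℕ → ℝ) {i n : ℕ} (hi : 3 ≤ i) (hn : i ≤ n)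
    (h0 : ∀ k, 3 ≤ k → k ≤ n → kernel r k 0 ≠ 0) :
    docKernel r n (n - i) = bdfSolve r (Pi.single i (1 : ℝ)) n := by
  rw [← sum_docKernel_smul r _ (hi.trans hn) h0, Finset.sum_eq_single i]
  · simp
  · intro j _ hj
    simp [hj]
  · intro h
    exact absurd (Finset.mem_Icc.2 ⟨hi, hn⟩) h

theorem bdfSolve_single_of_lt (r : ℕ → ℝ) {i n : ℕ} (hn : n < i) :
    bdfSolve r (Pi.single i (1 : ℝ)) n = 0 := by
  induction n using Nat.strong_induction_on with
  | _ n ih =>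
    match n with
    | 0 | 1 | 2 => rw [bdfSolve]
    | n + 3 =>
      rw [bdfSolve, ih (n + 2) (by omega) (by omega), ih (n + 1) (by omega) (by omega),
        Pi.single_eq_of_ne (by omega)]
      simp

theorem docKernel_abs_le (r : ℕ → ℝ) {i n : ℕ} (hi : 3 ≤ i) (hn : i ≤ n)
    (hr : ∀ k, 2 ≤ k → k ≤ n → 0 ≤ r k ∧ r k ≤ 3 / 2) :
    |docKernel r n (n - i)| ≤ 3 * (9 / 10) ^ (n - i) := by
  have hk0 : ∀ k, 3 ≤ k → k ≤ n → 1 ≤ kernel r k 0 := fun k h3 hkn =>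
    d0_ge_one (hr k (by omega) hkn).1 (hr (k - 1) (by omega) (by omega)).1
  rw [docKernel_eq_bdfSolve r hi hn fun k h3 hkn => (zero_lt_one.trans_le (hk0 k h3 hkn)).ne']
  set w := bdfSolve r (Pi.single i (1 : ℝ)) with hw
  have key : ∀ m, i + m ≤ n → |w (i + m - 1)| ≤ 3 * (9 / 10) ^ m ∧
      |w (i + m) - 2 / 5 * w (i + m - 1)| ≤ 3 / 2 * (9 / 10) ^ m ∧
      |w (i + m)| ≤ 3 * (9 / 10) ^ (m + 1) := by
    -- The constants fit exactly: `3/2 + (2/5)·3 = 27/10 = 3·(9/10)`.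
    have step : ∀ (P a b : ℝ), 0 < P → |a| ≤ 3 * P → |b - 2 / 5 * a| ≤ 3 / 2 * P →
        |b| ≤ 3 * (P * (9 / 10)) := by
      intro P a b hP ha hb
      have h1 : |b| ≤ |b - 2 / 5 * a| + |2 / 5 * a| := by
        simpa using abs_add_le (b - 2 / 5 * a) (2 / 5 * a)
      rw [abs_mul (2 / 5 : ℝ), abs_of_pos (by norm_num : (0 : ℝ) < 2 / 5)] at h1
      linarith
    intro m
    induction m with
    | zero =>
      intro _
      have h1 : w (i + 0 - 1) = 0 := bdfSolve_single_of_lt r (by omega)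
      have h2 : w (i + 0 - 2) = 0 := bdfSolve_single_of_lt r (by omega)
      have h3 := bdfConv_bdfSolve r (Pi.single i (1 : ℝ)) hi
        (zero_lt_one.trans_le (hk0 i hi hn)).ne'
      have h4 := hk0 i hi hn
      simp only [add_zero] at h1 h2
      rw [← hw, bdfConv, h1, h2, Pi.single_eq_same, smul_zero, smul_zero, add_zero, add_zero,
        smul_eq_mul] at h3
      have h5 : |w i| ≤ 1 := by
        rw [eq_div_of_mul_eq (by positivity) ((mul_comm _ _).trans h3), abs_of_pos (by positivity)]
        exact (div_le_one (by positivity)).2 h4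
      simp only [add_zero, h1, mul_zero, sub_zero, pow_zero, abs_zero]
      refine ⟨by norm_num, by linarith, by linarith⟩
    | succ m ih =>
      intro hm
      obtain ⟨ih1, ih2, ih3⟩ := ih (by omega)
      have hx := hr (i + (m + 1)) (by omega) hm
      have hy := hr (i + (m + 1) - 1) (by omega) (by omega)
      have h4 := hk0 (i + (m + 1)) (by omega) hm
      have h3 := bdfConv_bdfSolve r (Pi.single i (1 : ℝ)) (n := i + (m + 1)) (by omega)
        (zero_lt_one.trans_le h4).ne'
      have hb := contraction_bound hx.1 hy.1 hx.2 hy.2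
      rw [← hw, bdfConv, Pi.single_eq_of_ne (by omega)] at h3
      change 1 ≤ d0 _ _ at h4
      change d0 (r (i + (m + 1))) (r (i + (m + 1) - 1)) * w (i + (m + 1))
        + d1 (r (i + (m + 1))) (r (i + (m + 1) - 1)) * w (i + m)
        + d2 (r (i + (m + 1))) (r (i + (m + 1) - 1)) * w (i + m - 1) = 0 at h3
      have e : i + (m + 1) - 1 = i + m := rfl
      rw [e] at h3 h4 hb ⊢
      generalize d0 _ _ = D0 at h3 h4 hb
      generalize d1 _ _ = D1 at h3 hb
      generalize d2 _ _ = D2 at h3 hb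
      have hP : (0 : ℝ) < (9 / 10) ^ m := by positivity
      have hz : D0 * |w (i + (m + 1)) - 2 / 5 * w (i + m)| ≤ D0 * (3 / 2 * (9 / 10) ^ (m + 1)) := by
        calc D0 * |w (i + (m + 1)) - 2 / 5 * w (i + m)|
            = |D0 * (w (i + (m + 1)) - 2 / 5 * w (i + m))| := by
              rw [abs_mul D0, abs_of_pos (by linarith : 0 < D0)]
          _ = |(-D1 - 2 / 5 * D0) * (w (i + m) - 2 / 5 * w (i + m - 1))
                + (2 / 5 * (-D1 - 2 / 5 * D0) - D2) * w (i + m - 1)| := by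
              congr 1
              linarith
          _ ≤ |-D1 - 2 / 5 * D0| * (3 / 2 * (9 / 10) ^ m)
                + |2 / 5 * (-D1 - 2 / 5 * D0) - D2| * (3 * (9 / 10) ^ m) := by
              refine (abs_add_le _ _).trans ?_
              rw [abs_mul, abs_mul]
              gcongr
          _ = 3 / 2 * (9 / 10) ^ m *
                (|-D1 - 2 / 5 * D0| + 2 * |2 / 5 * (-D1 - 2 / 5 * D0) - D2|) := by ring
          _ ≤ 3 / 2 * (9 / 10) ^ m * (9 / 10 * D0) := by gcongr
          _ = D0 * (3 / 2 * (9 / 10) ^ (m + 1)) := by ring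
      have hz' := le_of_mul_le_mul_left hz (by linarith)
      refine ⟨ih3, hz', ?_⟩
      rw [pow_succ _ (m + 1)]
      exact step _ _ _ (by positivity) ih3 hz'
  have h := (key (n - i) (by omega)).2.2
  rw [Nat.add_sub_cancel' hn] at h
  refine h.trans ?_
  rw [pow_succ]
  have : (0 : ℝ) < (9 / 10) ^ (n - i) := by positivity
  linarith

theorem exists_isDOCBound : ∃ K : ℝ, IsDOCBound K := by
  have hr' : ∀ (r : ℕ → ℝ) (n : ℕ), (∀ k, 2 ≤ k → k ≤ n → 0 < r k ∧ r k ≤ stepRatioLimit) →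
      ∀ k, 2 ≤ k → k ≤ n → 0 ≤ r k ∧ r k ≤ 3 / 2 := fun r n h k h2 hk =>
    ⟨(h k h2 hk).1.le, (h k h2 hk).2.trans stepRatioLimit_lt.le⟩
  have geom : ∀ s : Finset ℕ, ∑ m ∈ s, 3 * (9 / 10 : ℝ) ^ m ≤ 30 := by
    intro s
    have hsum : Summable fun m : ℕ => (9 / 10 : ℝ) ^ m :=
      summable_geometric_of_lt_one (by norm_num) (by norm_num)
    rw [← Finset.mul_sum]
    have := hsum.sum_le_tsum s fun m _ => by positivity
    rw [tsum_geometric_of_lt_one (by norm_num) (by norm_num)] at this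
    linarith
  -- `30 = 3 / (1 - 9/10)`.
  refine ⟨30, by norm_num, ?_, ?_⟩
  · intro r n hn h
    calc ∑ j ∈ Finset.Icc 3 n, |docKernel r n (n - j)|
        ≤ ∑ j ∈ Finset.Icc 3 n, 3 * (9 / 10 : ℝ) ^ (n - j) :=
          Finset.sum_le_sum fun j hj =>
            docKernel_abs_le r (Finset.mem_Icc.1 hj).1 (Finset.mem_Icc.1 hj).2 (hr' r n h)
      _ = ∑ m ∈ Finset.range (n - 3 + 1), 3 * (9 / 10 : ℝ) ^ m :=
          sum_Icc_eq_sum_range (fun m _ => 3 * (9 / 10 : ℝ) ^ m) hn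
      _ ≤ 30 := geom _
  · intro r i n hi hn h
    calc ∑ j ∈ Finset.Icc i n, |docKernel r j (j - i)|
        ≤ ∑ j ∈ Finset.Icc i n, 3 * (9 / 10 : ℝ) ^ (j - i) :=
          Finset.sum_le_sum fun j hj =>
            docKernel_abs_le r hi (Finset.mem_Icc.1 hj).1
              (hr' r j fun k h2 hk => h k h2 (hk.trans (Finset.mem_Icc.1 hj).2))
      _ = ∑ m ∈ (Finset.Icc i n).image fun j => j - i, 3 * (9 / 10 : ℝ) ^ m := by
          rw [Finset.sum_image]
          intro a ha b hb hab
          simp only [Finset.coe_Icc, Set.mem_Icc] at ha hb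
          change a - i = b - i at hab
          omega
      _ ≤ 30 := geom _

/-! ### Positivity of the discrete BDF3 kernels -/

section
variable {W : Type*} [NormedAddCommGroup W] [InnerProductSpace ℝ W]

/-- The quadratic energy which dissipates under the BDF3 formula. -/
noncomputable def bdfEnergy (t : ℕ → ℝ) (y : ℕ → W) (k : ℕ) : ℝ :=
  stepSize t k * (3 / 4 + 9 / 32 * stepRatio t k) * inner ℝ (y k) (y k)
    - 3 / 4 * stepSize t k * inner ℝ (y k) (y (k - 1))
    + 1 / 2 * stepSize t (k - 1) * inner ℝ (y (k - 1)) (y (k - 1))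

theorem stepSize_eq_mul {t : ℕ → ℝ} {k : ℕ} (h : 0 < stepSize t (k - 1)) :
    stepSize t k = stepRatio t k * stepSize t (k - 1) := by
  rw [stepRatio, div_mul_cancel₀ _ h.ne']

theorem bdfEnergy_nonneg {t : ℕ → ℝ} (y : ℕ → W) {k : ℕ} (h0 : 0 < stepSize t (k - 1))
    (h1 : 0 < stepSize t k) : 0 ≤ bdfEnergy t y k := by
  have hx : 0 < stepRatio t k := div_pos h1 h0
  -- The weight `9/32 = (1/2)(3/4)²` is exactly what completes the square in `y (k - 1)`.
  have e : bdfEnergy t y k = stepSize t (k - 1) * (stepRatio t k * (3 / 4) * inner ℝ (y k) (y k)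
      + 1 / 2 * inner ℝ (y (k - 1) - (3 / 4 * stepRatio t k) • y k)
        (y (k - 1) - (3 / 4 * stepRatio t k) • y k)) := by
    rw [bdfEnergy, stepSize_eq_mul h0]
    simp only [inner_sub_left, inner_sub_right, real_inner_smul_left, real_inner_smul_right]
    rw [real_inner_comm (y k) (y (k - 1))]
    ring
  rw [e]
  have := real_inner_self_nonneg (x := y k)
  have := real_inner_self_nonneg (x := y (k - 1) - (3 / 4 * stepRatio t k) • y k)
  positivity

/-- Completing squares successively in `y (k - 1)`, `y k` and `y (k + 1)` writes the difference of
the two sides as three squares with nonnegative weights; the last weight is `discriminant_bound`. -/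
theorem bdfEnergy_step {t : ℕ → ℝ} (y : ℕ → W) {k : ℕ}
    (h0 : 0 < stepSize t (k - 1)) (h1 : 0 < stepSize t k) (h2 : 0 < stepSize t (k + 1))
    (hx : stepRatio t (k + 1) ≤ 3 / 2) (hy : stepRatio t k ≤ 3 / 2) :
    bdfEnergy t y (k + 1) ≤ bdfEnergy t y k
      + stepSize t (k + 1) * inner ℝ (y (k + 1)) (bdfConv (stepRatio t) y (k + 1)) := by
  have hx0 : 0 < stepRatio t (k + 1) := div_pos h2 h1
  have hy0 : 0 < stepRatio t k := div_pos h1 h0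
  have hd := discriminant_bound hx0.le hy0.le hx hy
  have e1 : k + 1 - 1 = k := rfl
  have e2 : k + 1 - 2 = k - 1 := rfl
  have hs2 : stepSize t (k + 1) = stepRatio t (k + 1) * stepSize t k := stepSize_eq_mul h1
  rw [bdfEnergy, bdfEnergy, bdfConv, e1, e2, hs2, stepSize_eq_mul h0]
  change _ ≤ _ + _ * inner ℝ _ (d0 (stepRatio t (k + 1)) (stepRatio t k) • _ +
    d1 (stepRatio t (k + 1)) (stepRatio t k) • _ + d2 (stepRatio t (k + 1)) (stepRatio t k) • _)
  generalize d0 _ _ = D0 at hd ⊢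
  generalize d1 _ _ = D1 at hd ⊢
  generalize d2 _ _ = D2 at hd ⊢
  generalize stepRatio t (k + 1) = x at *
  generalize stepRatio t k = z at *
  generalize stepSize t (k - 1) = s at *
  generalize y (k + 1) = a
  generalize y k = b
  generalize y (k - 1) = c
  set L := D1 + 3 / 4 + 3 / 4 * z * D2 with hL
  have q1 := real_inner_self_nonneg (x := c - (3 / 4 * z) • b + (x * z * D2) • a)
  have q2 := real_inner_self_nonneg (x := b + (2 * x * L) • a)
  have q3 := mul_nonneg (sub_nonneg.2 hd) (real_inner_self_nonneg (x := a))
  have q4 : 0 ≤ s * (1 / 2 * inner ℝ (c - (3 / 4 * z) • b + (x * z * D2) • a)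
      (c - (3 / 4 * z) • b + (x * z * D2) • a)
    + z * (1 / 4 * inner ℝ (b + (2 * x * L) • a) (b + (2 * x * L) • a)
      + x * ((D0 - 3 / 4 - 9 / 32 * x - x * z * D2 ^ 2 / 2 - x * L ^ 2) * inner ℝ a a))) := by
    positivity
  rw [← sub_nonneg]
  convert q4 using 1
  simp only [inner_sub_left, inner_sub_right, inner_add_left, inner_add_right,
    real_inner_smul_left, real_inner_smul_right]
  rw [real_inner_comm a b, real_inner_comm a c, real_inner_comm b c, hL]
  ring

theorem sum_inner_bdfConv_nonneg {t : ℕ → ℝ} {y : ℕ → W} (hy1 : y 1 = 0) (hy2 : y 2 = 0) {m : ℕ}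
    (hm : 2 ≤ m) (hs : ∀ k, 1 ≤ k → k ≤ m → 0 < stepSize t k)
    (hr : ∀ k, 2 ≤ k → k ≤ m → stepRatio t k ≤ 3 / 2) :
    0 ≤ ∑ k ∈ Finset.Icc 3 m, stepSize t k * inner ℝ (y k) (bdfConv (stepRatio t) y k) := by
  refine (bdfEnergy_nonneg y (hs (m - 1) (by omega) (by omega)) (hs m (by omega) le_rfl)).trans ?_
  induction m, hm using Nat.le_induction with
  | base => simp [bdfEnergy, hy1, hy2]
  | succ m hm ih =>
    rw [Finset.sum_Icc_succ_top (by omega)]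
    have h1 := ih (fun k h1 h2 => hs k h1 (by omega)) (fun k h1 h2 => hr k h1 (by omega))
    have h2 := bdfEnergy_step y (hs (m - 1) (by omega) (by omega)) (hs m (by omega) (by omega))
      (hs (m + 1) (by omega) le_rfl) (hr (m + 1) (by omega) le_rfl) (hr m (by omega) (by omega))
    linarith

/-- The scaled discrete orthogonal convolution kernels are positive semidefinite. -/
theorem sum_docKernel_inner_nonneg {t : ℕ → ℝ} (g : ℕ → W) {m : ℕ}
    (hm : 2 ≤ m) (hs : ∀ k, 1 ≤ k → k ≤ m → 0 < stepSize t k)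
    (hr : ∀ k, 2 ≤ k → k ≤ m → stepRatio t k ≤ 3 / 2)
    (h0 : ∀ k, 3 ≤ k → k ≤ m → kernel (stepRatio t) k 0 ≠ 0) :
    0 ≤ ∑ k ∈ Finset.Icc 3 m, stepSize t k *
      inner ℝ (∑ j ∈ Finset.Icc 3 k, docKernel (stepRatio t) k (k - j) • g j) (g k) := by
  -- Taking `y = ϑ * g`, whose BDF3 convolution is `g`, carries positivity over to the inverse
  -- kernels. Only `g_k` with `k ≥ 3` occur, so no gradients of the starting values are needed.
  have h := sum_inner_bdfConv_nonneg (y := bdfSolve (stepRatio t) g) (by rw [bdfSolve])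
    (by rw [bdfSolve]) hm hs hr
  refine h.trans_eq (Finset.sum_congr rfl fun k hk => ?_)
  rw [Finset.mem_Icc] at hk
  rw [sum_docKernel_smul _ g hk.1 fun j h3 hj => h0 j h3 (hj.trans hk.2),
    bdfConv_bdfSolve _ g hk.1 (h0 k hk.1 hk.2)]

end

/-! ### A sharp discrete Grönwall factor -/

theorem one_sub_inv_le_exp {s : ℝ} (h0 : 0 ≤ s) (h1 : s ≤ 1 / 2) : (1 - s)⁻¹ ≤ Real.exp (2 * s) := by
  have h := Real.add_one_le_exp (2 * s)
  rw [inv_le_iff_one_le_mul₀ (by linarith)]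
  nlinarith

theorem one_sub_mul_exp_ge {a a₀ : ℝ} (h0 : 0 ≤ a₀) (h : a₀ ≤ a) (ha : a ≤ 1 / 2) :
    1 + a₀ - 2 * a₀ ^ 3 ≤ (1 - a) * Real.exp (2 * a) := by
  have h1 : 1 + 2 * a₀ + 2 * a₀ ^ 2 ≤ Real.exp (2 * a₀) := by
    have := Real.quadratic_le_exp_of_nonneg (x := 2 * a₀) (by linarith)
    linarith
  have h2 := Real.add_one_le_exp (2 * (a - a₀))
  have h3 : Real.exp (2 * a) = Real.exp (2 * a₀) * Real.exp (2 * (a - a₀)) := by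
    rw [← Real.exp_add]; ring_nf
  have h4 : 1 - a₀ ≤ (1 - a) * Real.exp (2 * (a - a₀)) := by nlinarith
  calc 1 + a₀ - 2 * a₀ ^ 3 = (1 + 2 * a₀ + 2 * a₀ ^ 2) * (1 - a₀) := by ring
    _ ≤ Real.exp (2 * a₀) * ((1 - a) * Real.exp (2 * (a - a₀))) := by
        have : 0 ≤ 1 - a₀ := by linarith
        gcongr
    _ = _ := by rw [h3]; ring

/-- Here `a`, `b`, `c` are the last three scaled steps. The exponential omits `c`, and the factor 2
alone would only pay for `(1 - c)⁻¹ ≤ 2`. The ratio bounds give `b ≥ 2c/3` and `a ≥ 4c/9`, so the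
slack in `(1 - s)⁻¹ ≤ exp (2s)` at those two steps yields the surplus `143/100`. -/
theorem gronwall_factor_le {a b c : ℝ} (ha : a ≤ 1 / 2) (hb : b ≤ 1 / 2) (hc : c ≤ 1 / 2)
    (hc0 : 0 ≤ c) (hab : b ≤ 3 / 2 * a) (hbc : c ≤ 3 / 2 * b) :
    143 / 100 ≤ 2 * ((1 - c) * ((1 - b) * Real.exp (2 * b)) * ((1 - a) * Real.exp (2 * a))) := by
  have h1 := one_sub_mul_exp_ge (a₀ := 2 / 3 * c) (a := b) (by positivity) (by linarith) hb
  have h2 := one_sub_mul_exp_ge (a₀ := 4 / 9 * c) (a := a) (by positivity) (by linarith) ha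
  have key : 143 / 100 ≤ 2 * ((1 - c) * (1 + 2 / 3 * c - 2 * (2 / 3 * c) ^ 3)
      * (1 + 4 / 9 * c - 2 * (4 / 9 * c) ^ 3)) := by
    have hd : 0 ≤ 1 / 2 - c := by linarith
    have k1 : 0 ≤ 1 + 2 / 3 * c - 2 * (2 / 3 * c) ^ 3 := by nlinarith [mul_nonneg hc0 hc0]
    have k2 : 1 + 10 / 27 * c ≤ 1 + 4 / 9 * c - 2 * (4 / 9 * c) ^ 3 := by
      nlinarith [mul_nonneg hc0 hc0, mul_nonneg hc0 hd, mul_nonneg (mul_nonneg hc0 hc0) hd]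
    have k3 : 1 + 14 / 27 * c ≤ 1 + 2 / 3 * c - 2 * (2 / 3 * c) ^ 3 := by
      nlinarith [mul_nonneg hc0 hc0, mul_nonneg hc0 hd, mul_nonneg (mul_nonneg hc0 hc0) hd]
    have k4 : (1 - c) * (1 + 14 / 27 * c) * (1 + 10 / 27 * c) ≤
        (1 - c) * (1 + 2 / 3 * c - 2 * (2 / 3 * c) ^ 3) * (1 + 4 / 9 * c - 2 * (4 / 9 * c) ^ 3) := by
      have : 0 ≤ 1 - c := by linarith
      gcongr
    nlinarith [mul_nonneg hc0 hc0, mul_nonneg hc0 hd, mul_nonneg (mul_nonneg hc0 hc0) hd]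
  refine key.trans ?_
  have : 0 ≤ 1 - c := by linarith
  have k2 : 0 ≤ 1 + 4 / 9 * c - 2 * (4 / 9 * c) ^ 3 := by nlinarith [mul_nonneg hc0 hc0]
  have : 0 ≤ (1 - b) * Real.exp (2 * b) := mul_nonneg (by linarith) (Real.exp_pos _).le
  gcongr

theorem prod_one_sub_inv_le {s : ℕ → ℝ} {n : ℕ} (hn : 3 ≤ n)
    (h0 : ∀ k, 1 ≤ k → k ≤ n → 0 ≤ s k) (h1 : ∀ k, 1 ≤ k → k ≤ n → s k ≤ 1 / 2)
    (hr : ∀ k, 2 ≤ k → k ≤ n → s k ≤ 3 / 2 * s (k - 1)) :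
    143 / 100 * ∏ k ∈ Finset.Icc 3 n, (1 - s k)⁻¹ ≤
      2 * Real.exp (2 * ∑ k ∈ Finset.Icc 1 (n - 1), s k) := by
  obtain ⟨m, rfl⟩ := Nat.exists_eq_add_of_le' hn
  have e : m + 3 - 1 = m + 2 := rfl
  have hpos : ∀ k, 1 ≤ k → k ≤ m + 3 → 1 ≤ (1 - s k)⁻¹ := fun k hk hk' =>
    (one_le_inv₀ (by linarith [h1 k hk hk'])).2 (by linarith [h0 k hk hk'])
  -- Adding the factors `k = 1, 2`, each at least 1, provides three last steps even when `n = 3`.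
  have p1 : ∏ k ∈ Finset.Icc 3 (m + 3), (1 - s k)⁻¹ ≤ ∏ k ∈ Finset.Icc 1 (m + 3), (1 - s k)⁻¹ := by
    refine Finset.prod_le_prod_of_subset_of_one_le ?_ ?_ ?_
    · exact Finset.Icc_subset_Icc_left (by norm_num)
    · intro k hk
      rw [Finset.mem_Icc] at hk
      exact zero_le_one.trans (hpos k (by omega) hk.2)
    · intro k hk _
      rw [Finset.mem_Icc] at hk
      exact hpos k hk.1 hk.2
  have p2 : ∏ k ∈ Finset.Icc 1 m, (1 - s k)⁻¹ ≤ Real.exp (2 * ∑ k ∈ Finset.Icc 1 m, s k) := by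
    rw [Finset.mul_sum, Real.exp_sum]
    refine Finset.prod_le_prod ?_ ?_
    · intro k hk
      rw [Finset.mem_Icc] at hk
      exact zero_le_one.trans (hpos k hk.1 (by omega))
    · intro k hk
      rw [Finset.mem_Icc] at hk
      exact one_sub_inv_le_exp (h0 k hk.1 (by omega)) (h1 k hk.1 (by omega))
  have hf := gronwall_factor_le (h1 (m + 1) (by omega) (by omega)) (h1 (m + 2) (by omega) (by omega))
    (h1 (m + 3) (by omega) (by omega)) (h0 (m + 3) (by omega) (by omega))
    (hr (m + 2) (by omega) (by omega)) (hr (m + 3) (by omega) (by omega))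
  rw [e, Finset.sum_Icc_succ_top (by omega), Finset.sum_Icc_succ_top (by omega)]
  refine (mul_le_mul_of_nonneg_left p1 (by norm_num)).trans ?_
  rw [Finset.prod_Icc_succ_top (by omega), Finset.prod_Icc_succ_top (by omega),
    Finset.prod_Icc_succ_top (by omega), mul_add, mul_add, Real.exp_add, Real.exp_add]
  have ha : 0 < 1 - s (m + 1) := by linarith [h1 (m + 1) (by omega) (by omega)]
  have hb : 0 < 1 - s (m + 2) := by linarith [h1 (m + 2) (by omega) (by omega)]
  have hc : 0 < 1 - s (m + 3) := by linarith [h1 (m + 3) (by omega) (by omega)]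
  have hE := Real.exp_pos (2 * s (m + 1))
  have hE' := Real.exp_pos (2 * s (m + 2))
  have hP : 0 < ∏ k ∈ Finset.Icc 1 m, (1 - s k)⁻¹ := by
    refine Finset.prod_pos fun k hk => ?_
    rw [Finset.mem_Icc] at hk
    exact zero_lt_one.trans_le (hpos k hk.1 (by omega))
  have e1 : m + 1 + 1 = m + 2 := rfl
  have e2 : m + 2 + 1 = m + 3 := rfl
  rw [e1, e2]
  generalize ∏ k ∈ Finset.Icc 1 m, (1 - s k)⁻¹ = P at *
  generalize Real.exp (2 * ∑ k ∈ Finset.Icc 1 m, s k) = X at *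
  generalize Real.exp (2 * s (m + 1)) = A at *
  generalize Real.exp (2 * s (m + 2)) = B at *
  generalize 1 - s (m + 1) = a at *
  generalize 1 - s (m + 2) = b at *
  generalize 1 - s (m + 3) = c at *
  calc 143 / 100 * (P * a⁻¹ * b⁻¹ * c⁻¹)
      ≤ 2 * (c * (b * B) * (a * A)) * (X * a⁻¹ * b⁻¹ * c⁻¹) := by gcongr
    _ = 2 * (X * A * B) := by field_simp

theorem add_sum_mul_prod_one_sub_inv {s : ℕ → ℝ} (G : ℝ) {m : ℕ} (hm : 2 ≤ m)
    (h1 : ∀ k, 3 ≤ k → k ≤ m → s k < 1) :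
    G + ∑ k ∈ Finset.Icc 3 m, s k * (G * ∏ i ∈ Finset.Icc 3 k, (1 - s i)⁻¹) =
      G * ∏ i ∈ Finset.Icc 3 m, (1 - s i)⁻¹ := by
  induction m, hm using Nat.le_induction with
  | base => simp
  | succ m hm ih =>
    rw [Finset.sum_Icc_succ_top (by omega), ← add_assoc,
      ih fun k h3 hk => h1 k h3 (by omega), Finset.prod_Icc_succ_top (by omega)]
    have : 1 - s (m + 1) ≠ 0 := by linarith [h1 (m + 1) (by omega) le_rfl]
    field_simp
    ring

/-! ### The energy estimate in Hilbert spaces -/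

theorem IsTimeMesh.stepSize_pos {t : ℕ → ℝ} {N : ℕ} (ht : IsTimeMesh t N) {k : ℕ} (h1 : 1 ≤ k)
    (hk : k ≤ N) : 0 < stepSize t k := by
  obtain ⟨k, rfl⟩ := Nat.exists_eq_add_of_le' h1
  exact sub_pos.2 (ht.lt_succ k (by omega))

theorem IsTimeMesh.sum_stepSize {t : ℕ → ℝ} {N : ℕ} (ht : IsTimeMesh t N) (m : ℕ) :
    ∑ k ∈ Finset.Icc 1 m, stepSize t k = t m := by
  induction m with
  | zero => simp [ht.zero]
  | succ m ih =>
    rw [Finset.sum_Icc_succ_top (by omega), ih, stepSize, Nat.add_sub_cancel]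
    ring

theorem IsTimeMesh.sum_Icc_three_le {t : ℕ → ℝ} {N : ℕ} (ht : IsTimeMesh t N) {m n : ℕ}
    (hmn : m ≤ n) (hn : n ≤ N) : ∑ k ∈ Finset.Icc 3 m, stepSize t k ≤ t n := by
  rw [← ht.sum_stepSize n]
  refine Finset.sum_le_sum_of_subset_of_nonneg (Finset.Icc_subset_Icc (by norm_num) hmn) ?_
  intro k hk _
  rw [Finset.mem_Icc] at hk
  exact (ht.stepSize_pos hk.1 (hk.2.trans hn)).le

theorem stepSize_le_maxStep (t : ℕ → ℝ) {N k : ℕ} (hN : 1 ≤ N) (h1 : 1 ≤ k) (hk : k ≤ N) :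
    stepSize t k ≤ maxStep t N hN :=
  Finset.le_sup' (stepSize t) (Finset.mem_Icc.2 ⟨h1, hk⟩)

theorem kernel_zero_ne_zero {t : ℕ → ℝ} {N : ℕ}
    (hr : ∀ k, 2 ≤ k → k ≤ N → 0 < stepRatio t k ∧ stepRatio t k < stepRatioLimit) {k : ℕ} (h3 : 3 ≤ k) (hk : k ≤ N) : kernel (stepRatio t) k 0 ≠ 0 :=
  (zero_lt_one.trans_le
    (d0_ge_one (hr k (by omega) hk).1.le (hr (k - 1) (by omega) (by omega)).1.le)).ne'

section
variable {V W : Type*} [NormedAddCommGroup V] [InnerProductSpace ℝ V]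
  [NormedAddCommGroup W] [InnerProductSpace ℝ W]

/-- The contribution of the starting values to `∑ ϑ^{(k)}_{k-j} D₃ u^j`. -/
noncomputable def startTerm (t : ℕ → ℝ) (u : ℕ → V) (k : ℕ) : V :=
  (docKernel (stepRatio t) k (k - 3) * kernel (stepRatio t) 3 1
      + docPred (stepRatio t) k (k - 3) * kernel (stepRatio t) 4 2) • diffQuot t u 2
    + (docKernel (stepRatio t) k (k - 3) * kernel (stepRatio t) 3 2) • diffQuot t u 1

theorem sum_docKernel_D3 (t : ℕ → ℝ) (u : ℕ → V) {n : ℕ} (hn : 3 ≤ n)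
    (h0 : ∀ k, 3 ≤ k → k ≤ n → kernel (stepRatio t) k 0 ≠ 0) :
    ∑ j ∈ Finset.Icc 3 n, docKernel (stepRatio t) n (n - j) • D3 t u j =
      diffQuot t u n + startTerm t u n :=
  sum_docKernel_bdfConv (stepRatio t) (diffQuot t u) hn h0

section
variable {t : ℕ → ℝ} {N : ℕ} (ht : IsTimeMesh t N)
  (hr : ∀ k, 2 ≤ k → k ≤ N → 0 < stepRatio t k ∧ stepRatio t k < stepRatioLimit)
include ht hr

/-- Besides the sign of the diffusion form, this uses `‖a‖² - ‖b‖² ≤ 2⟨a - b, a⟩` and telescoping.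
-/
theorem energy_inequality {ε : ℝ} (hε : 0 ≤ ε) {u p : ℕ → V} {g : ℕ → W}
    (heq : ∀ k j, 3 ≤ k → k ≤ N → 3 ≤ j → j ≤ N →
      inner ℝ (D3 t u k) (u j) = -ε * inner ℝ (g k) (g j) + inner ℝ (p k) (u j))
    {m : ℕ} (hm : 2 ≤ m) (hmN : m ≤ N) :
    ‖u m‖ ^ 2 ≤ ‖u 2‖ ^ 2 + 2 * ∑ k ∈ Finset.Icc 3 m, stepSize t k *
      inner ℝ (∑ j ∈ Finset.Icc 3 k, docKernel (stepRatio t) k (k - j) • p j - startTerm t u k)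
        (u k) := by
  have hpsd := sum_docKernel_inner_nonneg g hm
    (fun k h1 hk => ht.stepSize_pos h1 (hk.trans hmN))
    (fun k h2 hk => ((hr k h2 (hk.trans hmN)).2.trans stepRatioLimit_lt).le)
    (fun k h3 hk => kernel_zero_ne_zero hr h3 (hk.trans hmN))
  have hstep : ∀ k ∈ Finset.Icc 3 m, ‖u k‖ ^ 2 - ‖u (k - 1)‖ ^ 2 ≤
      2 * (stepSize t k * inner ℝ
        (∑ j ∈ Finset.Icc 3 k, docKernel (stepRatio t) k (k - j) • p j - startTerm t u k) (u k))
      - 2 * ε * (stepSize t k *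
        inner ℝ (∑ j ∈ Finset.Icc 3 k, docKernel (stepRatio t) k (k - j) • g j) (g k)) := by
    intro k hk
    rw [Finset.mem_Icc] at hk
    have hkN := hk.2.trans hmN
    have hτ := ht.stepSize_pos (by omega : 1 ≤ k) hkN
    have h1 := congrArg (fun v => inner ℝ v (u k)) (sum_docKernel_D3 t u hk.1
      fun i h3 hi => kernel_zero_ne_zero hr h3 (hi.trans hkN))
    simp only [sum_inner, inner_add_left, real_inner_smul_left] at h1
    rw [Finset.sum_congr rfl fun j hj => by
      rw [heq j k (Finset.mem_Icc.1 hj).1 ((Finset.mem_Icc.1 hj).2.trans hkN) hk.1 hkN]] at h1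
    have h2 : 2 * (stepSize t k * inner ℝ (diffQuot t u k) (u k)) =
        2 * inner ℝ (u k - u (k - 1)) (u k) := by
      rw [diffQuot, real_inner_smul_left, mul_inv_cancel_left₀ hτ.ne']
    have h3 : ‖u k‖ ^ 2 - ‖u (k - 1)‖ ^ 2 ≤ 2 * inner ℝ (u k - u (k - 1)) (u k) := by
      have h4 := norm_sub_sq_real (u k) (u (k - 1))
      have h5 := sq_nonneg ‖u k - u (k - 1)‖
      rw [inner_sub_left, real_inner_self_eq_norm_sq, real_inner_comm]
      linarith
    refine h3.trans_eq ?_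
    rw [← h2, eq_sub_of_add_eq h1.symm]
    simp only [inner_sub_left, sum_inner, real_inner_smul_left, mul_add, Finset.sum_add_distrib]
    have h6 : ∑ j ∈ Finset.Icc 3 k, docKernel (stepRatio t) k (k - j) * (-ε * inner ℝ (g j) (g k)) =
        -ε * ∑ j ∈ Finset.Icc 3 k, docKernel (stepRatio t) k (k - j) * inner ℝ (g j) (g k) := by
      rw [Finset.mul_sum]
      exact Finset.sum_congr rfl fun j _ => by ring
    rw [h6]
    ring
  have hsum := Finset.sum_le_sum hstep
  have htel : ∑ k ∈ Finset.Icc 3 m, (‖u k‖ ^ 2 - ‖u (k - 1)‖ ^ 2) = ‖u m‖ ^ 2 - ‖u 2‖ ^ 2 := by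
    clear hpsd hstep hsum
    induction m, hm using Nat.le_induction with
    | base => simp
    | succ m hm ih =>
      rw [Finset.sum_Icc_succ_top (by omega), ih (by omega), Nat.add_sub_cancel]
      ring
  rw [htel, Finset.sum_sub_distrib, ← Finset.mul_sum, ← Finset.mul_sum] at hsum
  have := mul_nonneg (mul_nonneg zero_le_two hε) hpsd
  linarith

/-- Summed over `k`, the kernels in the starting terms form columns 3 and 4. The constants round up
`27/38` and `9/5 + 27/38`. -/
theorem sum_startTerm_le {K : ℝ} (hK : IsDOCBound K) (hN : 1 ≤ N) (u : ℕ → V) {m : ℕ} (hm : 3 ≤ m)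
    (hmN : m ≤ N) :
    ∑ k ∈ Finset.Icc 3 m, stepSize t k * ‖startTerm t u k‖ ≤
      K * maxStep t N hN * (143 / 200 * ‖diffQuot t u 1‖ + 63 / 25 * ‖diffQuot t u 2‖) := by
  have hτ0 : 0 ≤ maxStep t N hN :=
    (ht.stepSize_pos le_rfl hN).le.trans (stepSize_le_maxStep t hN le_rfl hN)
  have hr' : ∀ k, 2 ≤ k → k ≤ m → 0 < stepRatio t k ∧ stepRatio t k ≤ stepRatioLimit :=
    fun k h2 hk => ⟨(hr k h2 (hk.trans hmN)).1, (hr k h2 (hk.trans hmN)).2.le⟩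
  have hb : ∀ k, 2 ≤ k → k ≤ m → 0 ≤ stepRatio t k ∧ stepRatio t k ≤ 3 / 2 :=
    fun k h2 hk => ⟨(hr' k h2 hk).1.le, (hr' k h2 hk).2.trans stepRatioLimit_lt.le⟩
  have c3 := hK.col (stepRatio t) 3 m le_rfl hm hr'
  have c4 : ∑ k ∈ Finset.Icc 3 m,
      |docPred (stepRatio t) k (k - 3)| * |kernel (stepRatio t) 4 2| ≤ K * (27 / 38) := by
    rw [← Finset.sum_mul]
    -- For `m = 3` the ratio `r_4` may lie outside the mesh, but its coefficient `docPred` vanishes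
    -- at `k = 3`.
    rcases hm.eq_or_lt with rfl | hm4
    · have := hK.pos
      simp only [Finset.Icc_self, Finset.sum_singleton, docPred, Nat.sub_self, abs_zero, zero_mul]
      positivity
    · have c4 := hK.col (stepRatio t) 4 m (by norm_num) hm4 hr'
      have e : ∑ k ∈ Finset.Icc 3 m, |docPred (stepRatio t) k (k - 3)| =
          ∑ k ∈ Finset.Icc 4 m, |docKernel (stepRatio t) k (k - 4)| := by
        rw [← Finset.add_sum_Ioc_eq_sum_Icc hm]
        simp only [docPred, Nat.sub_self, abs_zero, zero_add]
        refine Finset.sum_congr (by ext; simp; omega) fun k hk => ?_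
        rw [Finset.mem_Icc] at hk
        obtain ⟨k, rfl⟩ := Nat.exists_eq_add_of_le' hk.1
        rfl
      rw [e]
      have q : |kernel (stepRatio t) 4 2| ≤ 27 / 38 := by
        have h3 := hb 3 (by norm_num) hm
        have h4 := hb 4 (by norm_num) hm4
        change |d2 (stepRatio t 4) (stepRatio t 3)| ≤ _
        rw [abs_of_nonneg (d2_nonneg h4.1 h3.1)]
        exact d2_le h4.1 h3.1 h4.2 h3.2
      have := hK.pos
      gcongr
  have h2 := hb 2 le_rfl (by omega)
  have h3 := hb 3 (by norm_num) hm
  have q1 : |kernel (stepRatio t) 3 1| ≤ 9 / 5 := abs_d1_le h3.1 h2.1 h3.2 h2.2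
  have q2 : |kernel (stepRatio t) 3 2| ≤ 27 / 38 := by
    change |d2 (stepRatio t 3) (stepRatio t 2)| ≤ _
    rw [abs_of_nonneg (d2_nonneg h3.1 h2.1)]
    exact d2_le h3.1 h2.1 h3.2 h2.2
  have hterm : ∀ k ∈ Finset.Icc 3 m, stepSize t k * ‖startTerm t u k‖ ≤ maxStep t N hN *
      (|docKernel (stepRatio t) k (k - 3)| * (9 / 5 * ‖diffQuot t u 2‖ + 27 / 38 * ‖diffQuot t u 1‖)
        + |docPred (stepRatio t) k (k - 3)| * |kernel (stepRatio t) 4 2| * ‖diffQuot t u 2‖) := by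
    intro k hk
    rw [Finset.mem_Icc] at hk
    have h1 := stepSize_le_maxStep t hN (by omega : 1 ≤ k) (hk.2.trans hmN)
    refine mul_le_mul h1 ?_ (norm_nonneg _) hτ0
    rw [startTerm]
    refine (norm_add_le _ _).trans ?_
    rw [norm_smul, norm_smul, Real.norm_eq_abs, Real.norm_eq_abs, abs_mul]
    calc _ ≤ (|docKernel (stepRatio t) k (k - 3)| * (9 / 5)
            + |docPred (stepRatio t) k (k - 3)| * |kernel (stepRatio t) 4 2|) * ‖diffQuot t u 2‖
          + |docKernel (stepRatio t) k (k - 3)| * (27 / 38) * ‖diffQuot t u 1‖ := by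
          gcongr
          refine (abs_add_le _ _).trans ?_
          rw [abs_mul, abs_mul]
          gcongr
      _ = _ := by ring
  refine (Finset.sum_le_sum hterm).trans ?_
  rw [← Finset.mul_sum, Finset.sum_add_distrib, ← Finset.sum_mul, ← Finset.sum_mul,
    mul_comm K, mul_assoc]
  refine mul_le_mul_of_nonneg_left ?_ hτ0
  have := hK.pos
  calc _ ≤ K * (9 / 5 * ‖diffQuot t u 2‖ + 27 / 38 * ‖diffQuot t u 1‖)
        + K * (27 / 38) * ‖diffQuot t u 2‖ := by gcongr
    _ ≤ _ := by
      rw [mul_assoc, ← mul_add]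
      refine mul_le_mul_of_nonneg_left ?_ this.le
      linarith [norm_nonneg (diffQuot t u 1), norm_nonneg (diffQuot t u 2)]

/-- Strong induction with the nondecreasing majorant `H`. If `M = ‖u (q + 1)‖` exceeds `H q`, it
dominates all earlier norms from level 2 on, so one factor `M` cancels from the quadratic
inequality. This leaves `M ≤ H q + s (q + 1) * M`, because `H` solves the Grönwall recursion with
equality (`add_sum_mul_prod_one_sub_inv`). -/
theorem norm_le_prod {K κs ε F : ℝ} (hK : IsDOCBound K) (hN : 1 ≤ N) (hε : 0 ≤ ε) (hκ : 0 < κs)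
    (hτ : maxStep t N hN ≤ 1 / (4 * K * κs)) {u f h : ℕ → V} {g : ℕ → W}
    (heq : ∀ k j, 3 ≤ k → k ≤ N → 3 ≤ j → j ≤ N →
      inner ℝ (D3 t u k) (u j) = -ε * inner ℝ (g k) (g j) + inner ℝ (h k + f k) (u j))
    (hh : ∀ k, 3 ≤ k → k ≤ N → ‖h k‖ ≤ κs * ‖u k‖) {n : ℕ} (hn : n ≤ N) (hF0 : 0 ≤ F)
    (hF : ∀ k, 3 ≤ k → k ≤ n → ‖f k‖ ≤ F) {m : ℕ} (hm : 2 ≤ m) (hmn : m ≤ n) :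
    ‖u m‖ ≤ (‖u 2‖ + 2 * (K * maxStep t N hN *
        (143 / 200 * ‖diffQuot t u 1‖ + 63 / 25 * ‖diffQuot t u 2‖)) + 2 * K * t n * F)
      * ∏ k ∈ Finset.Icc 3 m, (1 - 2 * K * κs * stepSize t k)⁻¹ := by
  have hK0 := hK.pos
  have hτ0 : 0 ≤ maxStep t N hN :=
    (ht.stepSize_pos le_rfl hN).le.trans (stepSize_le_maxStep t hN le_rfl hN)
  have hs : ∀ k, 1 ≤ k → k ≤ N → 2 * K * κs * stepSize t k ≤ 1 / 2 := by
    intro k h1 hk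
    have h2 := (stepSize_le_maxStep t hN h1 hk).trans hτ
    rw [le_div_iff₀ (by positivity)] at h2
    linarith
  have hs0 : ∀ k, 1 ≤ k → k ≤ N → 0 < 2 * K * κs * stepSize t k := by
    intro k h1 hk
    have := ht.stepSize_pos h1 hk
    positivity
  have htn : 0 ≤ t n := by
    rw [← ht.sum_stepSize n]
    exact Finset.sum_nonneg fun k hk =>
      (ht.stepSize_pos (Finset.mem_Icc.1 hk).1 ((Finset.mem_Icc.1 hk).2.trans hn)).le
  set S := K * maxStep t N hN * (143 / 200 * ‖diffQuot t u 1‖ + 63 / 25 * ‖diffQuot t u 2‖) with hS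
  have hS0 : 0 ≤ S := by positivity
  set G := ‖u 2‖ + 2 * S + 2 * K * t n * F with hG
  have hG0 : 0 ≤ G := by positivity
  set s := fun k => 2 * K * κs * stepSize t k with hsdef
  set H := fun k => G * ∏ i ∈ Finset.Icc 3 k, (1 - s i)⁻¹ with hH
  change ‖u m‖ ≤ H m
  have hH0 : ∀ k, k ≤ N → 0 ≤ H k := by
    intro k hk
    refine mul_nonneg hG0 (Finset.prod_nonneg fun i hi => ?_)
    rw [Finset.mem_Icc] at hi
    have := hs i (by omega) (hi.2.trans hk)
    exact inv_nonneg.2 (by simp only [hsdef]; linarith)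
  have hHmono : ∀ j k, 2 ≤ j → j ≤ k → k ≤ N → H j ≤ H k := by
    intro j k hj hjk
    induction k, hjk using Nat.le_induction with
    | base => intro _; exact le_rfl
    | succ k hk ih =>
      intro hkN
      refine (ih (by omega)).trans ?_
      have h1 : H (k + 1) = H k * (1 - s (k + 1))⁻¹ := by
        simp only [hH]
        rw [Finset.prod_Icc_succ_top (by omega), mul_assoc]
      rw [h1]
      have h2 := hs (k + 1) (by omega) hkN
      have h3 := hs0 (k + 1) (by omega) hkN
      refine le_mul_of_one_le_right (hH0 k (by omega)) ?_
      exact (one_le_inv₀ (by simp only [hsdef]; linarith)).2 (by simp only [hsdef]; linarith)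
  induction m using Nat.strong_induction_on with
  | _ m ih =>
    rcases hm.eq_or_lt with rfl | hm3
    · simp only [hH]
      simp only [Finset.Icc_eq_empty_of_lt (by norm_num : 2 < 3), Finset.prod_empty, mul_one, hG]
      have : 0 ≤ 2 * K * t n * F := by positivity
      linarith
    · obtain ⟨q, rfl⟩ : ∃ q, m = q + 1 := ⟨m - 1, by omega⟩
      rcases le_or_gt ‖u (q + 1)‖ (H q) with hle | hgt
      · exact hle.trans (hHmono q (q + 1) (by omega) (by omega) (by omega))
      · set M := ‖u (q + 1)‖ with hM
        have hM0 : 0 < M := (hH0 q (by omega)).trans_lt hgt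
        have hj : ∀ j, 2 ≤ j → j ≤ q → ‖u j‖ ≤ H j := fun j h2 hjq =>
          ih j (by omega) h2 (by omega)
        have hjM : ∀ j, 2 ≤ j → j ≤ q + 1 → ‖u j‖ ≤ M := by
          intro j h2 hjq
          rcases Nat.le_succ_iff.1 hjq with h3 | rfl
          · exact ((hj j h2 h3).trans (hHmono j q h2 h3 (by omega))).trans hgt.le
          · exact le_rfl
        have hterm : ∀ B : ℝ, ∀ k, 3 ≤ k → k ≤ q + 1 → (∀ j, 3 ≤ j → j ≤ k → ‖u j‖ ≤ B) →
            stepSize t k * inner ℝ (∑ j ∈ Finset.Icc 3 k,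
              docKernel (stepRatio t) k (k - j) • (h j + f j) - startTerm t u k) (u k) ≤
            M * (stepSize t k * (K * κs * B) + stepSize t k * (K * F)
              + stepSize t k * ‖startTerm t u k‖) := by
          intro B k h3 hk hB
          have hτk := ht.stepSize_pos (by omega : 1 ≤ k) (by omega)
          have hB0 : 0 ≤ B := (norm_nonneg _).trans (hB k h3 le_rfl)
          have hrow := hK.row (stepRatio t) k h3 fun i h2 hi =>
            ⟨(hr i h2 (by omega)).1, (hr i h2 (by omega)).2.le⟩
          have h1 : ‖∑ j ∈ Finset.Icc 3 k, docKernel (stepRatio t) k (k - j) • (h j + f j)‖ ≤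
              K * (κs * B + F) := by
            refine (norm_sum_le_of_le _ fun j hj => ?_).trans
              ((Finset.sum_mul _ _ _).symm.trans_le
                (mul_le_mul_of_nonneg_right hrow (by positivity)))
            rw [Finset.mem_Icc] at hj
            rw [norm_smul, Real.norm_eq_abs]
            refine mul_le_mul_of_nonneg_left ((norm_add_le _ _).trans ?_) (abs_nonneg _)
            refine add_le_add ((hh j hj.1 (by omega)).trans ?_) (hF j hj.1 (by omega))
            exact mul_le_mul_of_nonneg_left (hB j hj.1 hj.2) hκ.le
          have h2 := (real_inner_le_norm (∑ j ∈ Finset.Icc 3 k,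
              docKernel (stepRatio t) k (k - j) • (h j + f j) - startTerm t u k) (u k)).trans
            (mul_le_mul ((norm_sub_le _ _).trans (add_le_add_left h1 _)) (hjM k (by omega) hk)
              (norm_nonneg _) (by positivity))
          refine (mul_le_mul_of_nonneg_left h2 hτk.le).trans_eq ?_
          ring
        have hE := energy_inequality ht hr hε heq hm (hmn.trans hn)
        have hstart := sum_startTerm_le ht hr hK hN u hm3 (hmn.trans hn)
        have htime := ht.sum_Icc_three_le hmn hn
        have hsum : ∑ k ∈ Finset.Icc 3 (q + 1), stepSize t k * inner ℝ (∑ j ∈ Finset.Icc 3 k,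
              docKernel (stepRatio t) k (k - j) • (h j + f j) - startTerm t u k) (u k) ≤
            M * (∑ k ∈ Finset.Icc 3 q, stepSize t k * (K * κs * H k)
              + stepSize t (q + 1) * (K * κs * M)
              + ∑ k ∈ Finset.Icc 3 (q + 1), stepSize t k * (K * F)
              + ∑ k ∈ Finset.Icc 3 (q + 1), stepSize t k * ‖startTerm t u k‖) := by
          have e : ∀ φ : ℕ → ℝ,
              ∑ k ∈ Finset.Icc 3 (q + 1), φ k = ∑ k ∈ Finset.Icc 3 q, φ k + φ (q + 1) :=
            fun φ => Finset.sum_Icc_succ_top (by omega) φ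
          rw [e, e, e]
          have h1 := Finset.sum_le_sum (s := Finset.Icc 3 q) fun k hk =>
            hterm (H k) k (Finset.mem_Icc.1 hk).1 ((Finset.mem_Icc.1 hk).2.trans (by omega))
              fun j h3 hjk => (hj j (by omega) (hjk.trans (Finset.mem_Icc.1 hk).2)).trans
                (hHmono j k (by omega) hjk ((Finset.mem_Icc.1 hk).2.trans (by omega)))
          -- At the top level the bound `H` is not yet available; using `M` itself gives the
          -- implicit term, absorbed later since `s (q + 1) ≤ 1/2`.
          have h2 := hterm M (q + 1) (by omega) le_rfl fun j h3 hj' => hjM j (by omega) hj'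
          rw [← Finset.mul_sum, Finset.sum_add_distrib, Finset.sum_add_distrib] at h1
          linarith
        have hgr := add_sum_mul_prod_one_sub_inv (s := s) G (m := q) (by omega) fun k h3 hk =>
          lt_of_le_of_lt (hs k (by omega) (by omega)) (by norm_num)
        change G + ∑ k ∈ Finset.Icc 3 q, s k * H k = H q at hgr
        have hsH : 2 * ∑ k ∈ Finset.Icc 3 q, stepSize t k * (K * κs * H k) =
            ∑ k ∈ Finset.Icc 3 q, s k * H k := by
          rw [Finset.mul_sum]
          exact Finset.sum_congr rfl fun k _ => by simp only [hsdef]; ring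
        have hFsum : ∑ k ∈ Finset.Icc 3 (q + 1), stepSize t k * (K * F) ≤ t n * (K * F) := by
          rw [← Finset.sum_mul]
          exact mul_le_mul_of_nonneg_right htime (by positivity)
        have hu2 : ‖u 2‖ ^ 2 ≤ M * ‖u 2‖ := by
          rw [sq]
          exact mul_le_mul_of_nonneg_right (hjM 2 le_rfl hm) (norm_nonneg _)
        have hMM : M * M ≤ M * (H q + s (q + 1) * M) := by
          calc M * M = M ^ 2 := (sq M).symm
            _ ≤ M * ‖u 2‖ + 2 * (M * (∑ k ∈ Finset.Icc 3 q, stepSize t k * (K * κs * H k)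
              + stepSize t (q + 1) * (K * κs * M) + t n * (K * F) + S)) := by
                refine hE.trans (add_le_add hu2 (mul_le_mul_of_nonneg_left (hsum.trans ?_) zero_le_two))
                gcongr
            _ = M * (G + 2 * ∑ k ∈ Finset.Icc 3 q, stepSize t k * (K * κs * H k)
                + s (q + 1) * M) := by
                simp only [hsdef, hG]; ring
            _ = M * (H q + s (q + 1) * M) := by rw [hsH, hgr]
        have h1 := le_of_mul_le_mul_left hMM hM0
        have h2 : 0 < 1 - s (q + 1) := by
          have := hs (q + 1) (by omega) (by omega)
          simp only [hsdef]; linarith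
        have h3 : H (q + 1) = H q * (1 - s (q + 1))⁻¹ := by
          simp only [hH]
          rw [Finset.prod_Icc_succ_top (by omega), mul_assoc]
        rw [h3, ← div_eq_mul_inv, le_div_iff₀ h2]
        linarith

theorem norm_le_exp {K κs ε : ℝ} (hK : IsDOCBound K) (hN : 1 ≤ N) (hε : 0 ≤ ε) (hκ : 0 < κs)
    (hτ : maxStep t N hN ≤ 1 / (4 * K * κs)) {u f h : ℕ → V} {g : ℕ → W}
    (heq : ∀ k j, 3 ≤ k → k ≤ N → 3 ≤ j → j ≤ N →
      inner ℝ (D3 t u k) (u j) = -ε * inner ℝ (g k) (g j) + inner ℝ (h k + f k) (u j))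
    (hh : ∀ k, 3 ≤ k → k ≤ N → ‖h k‖ ≤ κs * ‖u k‖) {n : ℕ} (hn3 : 3 ≤ n) (hn : n ≤ N) :
    ‖u n‖ ≤ 2 * Real.exp (4 * K * κs * t (n - 1)) *
        (‖u 2‖ + K * maxStep t N hN * ‖diffQuot t u 1‖
          + 4 * K * maxStep t N hN * ‖diffQuot t u 2‖
          + 2 * K * t n *
            (Finset.Icc 3 n).sup' (Finset.nonempty_Icc.2 hn3) (fun k => ‖f k‖)) := by
  set F := (Finset.Icc 3 n).sup' (Finset.nonempty_Icc.2 hn3) (fun k => ‖f k‖)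
  have hF : ∀ k, 3 ≤ k → k ≤ n → ‖f k‖ ≤ F := fun k h3 hk =>
    Finset.le_sup' (fun k => ‖f k‖) (Finset.mem_Icc.2 ⟨h3, hk⟩)
  have hF0 : 0 ≤ F := (norm_nonneg _).trans (hF 3 le_rfl hn3)
  have hK0 := hK.pos
  have hτ0 : 0 ≤ maxStep t N hN :=
    (ht.stepSize_pos le_rfl hN).le.trans (stepSize_le_maxStep t hN le_rfl hN)
  have htn : 0 ≤ t n := by
    rw [← ht.sum_stepSize n]
    exact Finset.sum_nonneg fun k hk =>
      (ht.stepSize_pos (Finset.mem_Icc.1 hk).1 ((Finset.mem_Icc.1 hk).2.trans hn)).le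
  have h1 := norm_le_prod ht hr hK hN hε hκ hτ heq hh hn hF0 hF (by omega : 2 ≤ n) le_rfl
  have h2 := prod_one_sub_inv_le (s := fun k => 2 * K * κs * stepSize t k) hn3
    (fun k hk1 hk => by
      have := ht.stepSize_pos hk1 (hk.trans hn)
      positivity)
    (fun k hk1 hk => by
      have h2 := (stepSize_le_maxStep t hN hk1 (hk.trans hn)).trans hτ
      rw [le_div_iff₀ (by positivity)] at h2
      linarith)
    (fun k hk1 hk => by
      have h3 := ht.stepSize_pos (by omega : 1 ≤ k - 1) (by omega)
      have h4 := (hr k hk1 (hk.trans hn)).2.trans stepRatioLimit_lt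
      change 2 * K * κs * stepSize t k ≤ 3 / 2 * (2 * K * κs * stepSize t (k - 1))
      rw [stepSize_eq_mul h3, mul_left_comm (3 / 2 : ℝ)]
      gcongr)
  rw [← Finset.mul_sum, ht.sum_stepSize] at h2
  have e : 2 * (2 * K * κs * t (n - 1)) = 4 * K * κs * t (n - 1) := by ring
  rw [e] at h2
  have h3 : 0 ≤ ∏ k ∈ Finset.Icc 3 n, (1 - 2 * K * κs * stepSize t k)⁻¹ := by
    refine Finset.prod_nonneg fun k hk => inv_nonneg.2 ?_
    rw [Finset.mem_Icc] at hk
    have h2 := (stepSize_le_maxStep t hN (by omega : 1 ≤ k) (hk.2.trans hn)).trans hτ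
    rw [le_div_iff₀ (by positivity)] at h2
    linarith
  set A := ‖u 2‖ + K * maxStep t N hN * ‖diffQuot t u 1‖ + 4 * K * maxStep t N hN * ‖diffQuot t u 2‖
    + 2 * K * t n * F with hA
  have hA0 : 0 ≤ A := by positivity
  -- The surplus `143/100` is spent here: `2·143/200 = 143/100` and `2·63/25 ≤ 4·143/100`.
  have h4 : ‖u 2‖ + 2 * (K * maxStep t N hN *
        (143 / 200 * ‖diffQuot t u 1‖ + 63 / 25 * ‖diffQuot t u 2‖)) + 2 * K * t n * F ≤
      143 / 100 * A := by
    have q1 : 0 ≤ K * maxStep t N hN * ‖diffQuot t u 2‖ := by positivity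
    have q2 : 0 ≤ 2 * K * t n * F := by positivity
    have q3 := norm_nonneg (u 2)
    rw [hA]
    linarith
  calc ‖u n‖ ≤ 143 / 100 * A * ∏ k ∈ Finset.Icc 3 n, (1 - 2 * K * κs * stepSize t k)⁻¹ :=
        h1.trans (mul_le_mul_of_nonneg_right h4 h3)
    _ = (143 / 100 * ∏ k ∈ Finset.Icc 3 n, (1 - 2 * K * κs * stepSize t k)⁻¹) * A := by ring
    _ ≤ _ := mul_le_mul_of_nonneg_right h2 hA0

end

end

/-! ### The weak formulation -/

section
variable {d : ℕ} {Ω : Set (EuclideanSpace ℝ (Fin d))}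

theorem exists_mul_mem_L2 (hΩ : IsOpen Ω) {κ : EuclideanSpace ℝ (Fin d) → ℝ} {κs : ℝ}
    (hκm : AEStronglyMeasurable κ (volume.restrict Ω)) (hκ : ∀ x ∈ Ω, |κ x| ≤ κs) (v : L2 Ω) :
    ∃ h : L2 Ω, (h =ᵐ[volume.restrict Ω] fun x => κ x * v x) ∧ ‖h‖ ≤ κs * ‖v‖ := by
  have hae : ∀ᵐ x ∂volume.restrict Ω, ‖κ x * v x‖ ≤ κs * ‖v x‖ := by
    filter_upwards [ae_restrict_mem hΩ.measurableSet] with x hx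
    rw [norm_mul, Real.norm_eq_abs]
    exact mul_le_mul_of_nonneg_right (hκ x hx) (norm_nonneg _)
  have hmem : MemLp (fun x => κ x * v x) 2 (volume.restrict Ω) :=
    (Lp.memLp v).of_le_mul (hκm.mul (Lp.aestronglyMeasurable v)) hae
  refine ⟨hmem.toLp _, hmem.coeFn_toLp, Lp.norm_le_mul_norm_of_ae_le_mul ?_⟩
  filter_upwards [hmem.coeFn_toLp, hae] with x h1 h2
  rwa [h1]

/-- A weak identity extends from test functions to `H¹₀(Ω)`. -/
theorem inner_eq_of_mem_closure {ε : ℝ} {F p : L2 Ω} {g : L2Vec Ω}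
    (h : ∀ φ, IsTestFunction Ω φ → ∫ x in Ω, F x * φ x =
      -ε * (∫ x in Ω, inner ℝ (g x) (gradient φ x)) + ∫ x in Ω, p x * φ x)
    {q : L2 Ω × L2Vec Ω} (hq : q ∈ closure (testGraph Ω)) :
    inner ℝ F q.1 = -ε * inner ℝ g q.2 + inner ℝ p q.1 := by
  have hclosed : IsClosed {q : L2 Ω × L2Vec Ω |
      inner ℝ F q.1 = -ε * inner ℝ g q.2 + inner ℝ p q.1} :=
    isClosed_eq (by fun_prop) (by fun_prop)
  refine closure_minimal ?_ hclosed hq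
  rintro ⟨v, w⟩ ⟨φ, hφ, h1, h2⟩
  have hL : ∀ f : L2 Ω, inner ℝ f v = ∫ x in Ω, f x * φ x := by
    intro f
    rw [L2.inner_def]
    refine integral_congr_ae ?_
    filter_upwards [h1] with x hx
    rw [hx, RCLike.inner_apply, conj_trivial, mul_comm]
  have hW : inner ℝ g w = ∫ x in Ω, inner ℝ (g x) (gradient φ x) := by
    rw [L2.inner_def]
    refine integral_congr_ae ?_
    filter_upwards [h2] with x hx
    rw [hx]
  change inner ℝ F v = -ε * inner ℝ g w + inner ℝ p v
  rw [hL, hL, hW]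
  exact h φ hφ

end

end BDF3

theorem mainTheorem5 :
    (∃ K₃ : ℝ, IsDOCBound K₃) ∧
    ∀ (K₃ : ℝ), IsDOCBound K₃ →
    ∀ (d : ℕ) (Ω : Set (EuclideanSpace ℝ (Fin d))), IsOpen Ω →
    ∀ (ε : ℝ), 0 < ε →
    ∀ (κ : EuclideanSpace ℝ (Fin d) → ℝ) (κs : ℝ), 0 < κs →
      AEStronglyMeasurable κ (volume.restrict Ω) → (∀ x ∈ Ω, |κ x| ≤ κs) →
    ∀ (t : ℕ → ℝ) (N : ℕ) (hN : 1 ≤ N), IsTimeMesh t N →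
      (∀ k, 2 ≤ k → k ≤ N → 0 < stepRatio t k ∧ stepRatio t k < stepRatioLimit) →
      maxStep t N hN ≤ 1 / (4 * K₃ * κs) →
    ∀ (f u : ℕ → L2 Ω), IsBDF3Solution Ω ε κ t N f u →
    ∀ (n : ℕ) (hn : 3 ≤ n), n ≤ N →
      ‖u n‖ ≤ 2 * Real.exp (4 * K₃ * κs * t (n - 1)) *
        (‖u 2‖ + K₃ * maxStep t N hN * ‖diffQuot t u 1‖
          + 4 * K₃ * maxStep t N hN * ‖diffQuot t u 2‖
          + 2 * K₃ * t n *
            (Finset.Icc 3 n).sup' (Finset.nonempty_Icc.2 hn) (fun k => ‖f k‖)) := by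
  refine ⟨exists_isDOCBound, ?_⟩
  intro K hK d Ω hΩ ε hε κ κs hκs hκm hκ t N hN ht hr hτ f u hu n hn hnN
  have hu' : ∀ k, ∃ g : L2Vec Ω, 3 ≤ k → k ≤ N → MemH10 (u k) g ∧
      ∀ φ, IsTestFunction Ω φ → ∫ x in Ω, D3 t u k x * φ x =
        -ε * (∫ x in Ω, inner ℝ (g x) (gradient φ x))
          + ∫ x in Ω, (κ x * u k x + f k x) * φ x := by
    intro k
    by_cases hk : 3 ≤ k ∧ k ≤ N
    · obtain ⟨g, hg⟩ := hu k hk.1 hk.2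
      exact ⟨g, fun _ _ => hg⟩
    · exact ⟨0, fun h1 h2 => absurd ⟨h1, h2⟩ hk⟩
  choose g hg using hu'
  choose h hh hhn using fun k => exists_mul_mem_L2 hΩ hκm hκ (u k)
  refine norm_le_exp ht hr hK hN hε.le hκs hτ (h := h) (g := g) ?_ (fun k _ _ => hhn k) hn hnN
  intro k j hk hkN hj hjN
  -- By density, the equation at level `k` may be tested with the solution at any level `j ≥ 3`, as
  -- the convolution with `ϑ` requires.
  refine inner_eq_of_mem_closure (q := (u j, g j)) ?_ (hg j hj hjN).1.mem_closure
  intro φ hφ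
  rw [(hg k hk hkN).2 φ hφ]
  congr 1
  refine integral_congr_ae ?_
  filter_upwards [hh k, Lp.coeFn_add (h k) (f k)] with x h1 h2
  rw [h2, Pi.add_apply, h1]
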